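/- Let $K$ be an algebraically closed field (of any characteristic), and let $P\subset\mathbb{R}^2$ be a lattice polygon, that is, a two-dimensional polytope whose vertices lie in $\mathbb{Z}^2$. Let $S_P\subset\mathbb{Z}^2\times\mathbb{Z}$ be the semigroup generated by $(P\cap\mathbb{Z}^2)\times\{1\}$, graded by the last coordinate, and let $X_P=\operatorname{Proj}K[S_P]$ be the corresponding projective toric surface, embedded in the projective space $\mathbb{P}^n$, $n+1=\#(P\cap\mathbb{Z}^2)$, by the surjection $K[x_u\mid u\in P\cap\mathbb{Z}^2]\to K[S_P]$ that sends $x_u$ to the generator $(u,1)$. Let $\mathbf{F}_1(X_P)$ be the Fano scheme of lines of $X_P$, that is, the fine moduli space of lines of $\mathbb{P}^n$ contained in $X_P$, a closed subscheme of the Grassmannian of lines in $\mathbb{P}^n$. If $X_P$ is non-singular (all its local rings are regular), then $\mathbf{F}_1(X_P)$ is non-singular. In particular, $\mathbf{F}_1(X_P)$ is reduced. -/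

import Mathlib

noncomputable section

namespace FanoToric

/-! ### Non-singular schemes -/

/-- A scheme is non-singular if all of its local rings are regular local rings.  (In Mathlib a
regular local ring is Noetherian by definition.) -/
def IsNonsingular (X : AlgebraicGeometry.Scheme) : Prop :=
  ∀ x : X, IsRegularLocalRing (X.presheaf.stalk x)

/-! ### The quotient of a graded algebra by a homogeneous ideal -/

section Quotient

variable {K A : Type*} [Field K] [CommRing A] [Algebra K A] (𝒜 : ℕ → Submodule K A)
  [GradedAlgebra 𝒜]

/-- The grading on `A ⧸ I` induced by a grading of `A`: the images of the graded pieces. -/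
def quotientGrading (I : HomogeneousIdeal 𝒜) (n : ℕ) : Submodule K (A ⧸ I.toIdeal) :=
  (𝒜 n).map (Ideal.Quotient.mkₐ K I.toIdeal).toLinearMap

instance quotientGrading.gradedMonoid (I : HomogeneousIdeal 𝒜) :
    SetLike.GradedMonoid (quotientGrading 𝒜 I) where
  one_mem := ⟨1, SetLike.GradedOne.one_mem, rfl⟩
  mul_mem := by
    rintro i j _ _ ⟨a, ha, rfl⟩ ⟨b, hb, rfl⟩
    exact ⟨a * b, SetLike.GradedMul.mul_mem ha hb, rfl⟩

/-- The map from `A` to the direct sum of the graded pieces of `A ⧸ I`, which sends an element to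
the classes of its homogeneous components. -/
def quotientDecomposeAux (I : HomogeneousIdeal 𝒜) :
    A →ₗ[K] DirectSum ℕ (fun n => quotientGrading 𝒜 I n) :=
  (DirectSum.lmap (fun n => ((Ideal.Quotient.mkₐ K I.toIdeal).toLinearMap.restrict
    (p := 𝒜 n) (q := quotientGrading 𝒜 I n) (fun a ha => ⟨a, ha, rfl⟩)))) ∘ₗ
    (DirectSum.decomposeLinearEquiv 𝒜).toLinearMap

theorem quotientDecomposeAux_apply (I : HomogeneousIdeal 𝒜) (a : A) (n : ℕ) :
    ((quotientDecomposeAux 𝒜 I a n : quotientGrading 𝒜 I n) : A ⧸ I.toIdeal) =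
      Ideal.Quotient.mk I.toIdeal (DirectSum.decompose 𝒜 a n : A) := by
  rfl

theorem quotientDecomposeAux_of_mem (I : HomogeneousIdeal 𝒜) (a : A) (ha : a ∈ I.toIdeal) :
    quotientDecomposeAux 𝒜 I a = 0 := by
  ext n
  rw [quotientDecomposeAux_apply]
  simpa [Ideal.Quotient.eq_zero_iff_mem] using I.isHomogeneous n ha

theorem quotientDecomposeAux_homogeneous (I : HomogeneousIdeal 𝒜) (n : ℕ) (a : 𝒜 n) :
    quotientDecomposeAux 𝒜 I a = DirectSum.lof K ℕ (fun n => quotientGrading 𝒜 I n) n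
      ⟨Ideal.Quotient.mk I.toIdeal a, a, a.2, rfl⟩ := by
  unfold quotientDecomposeAux
  rw [LinearMap.comp_apply, LinearEquiv.coe_coe, DirectSum.decomposeLinearEquiv_apply,
    DirectSum.decompose_coe, ← DirectSum.lof_eq_of K, DirectSum.lmap_lof]
  rfl

theorem coeLinearMap_quotientDecomposeAux (I : HomogeneousIdeal 𝒜) (a : A) :
    DirectSum.coeLinearMap (quotientGrading 𝒜 I) (quotientDecomposeAux 𝒜 I a) =
      Ideal.Quotient.mk I.toIdeal a := by
  induction a using DirectSum.Decomposition.inductionOn 𝒜 with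
  | zero => rw [map_zero, map_zero, map_zero]
  | homogeneous a => rw [quotientDecomposeAux_homogeneous, DirectSum.coeLinearMap_lof]
  | add a b ha hb => rw [map_add, map_add, map_add, ha, hb]

/-- The map from `A ⧸ I` to the direct sum of its graded pieces. -/
def quotientDecompose (I : HomogeneousIdeal 𝒜) :
    (A ⧸ I.toIdeal) →+ DirectSum ℕ (fun n => quotientGrading 𝒜 I n) :=
  QuotientAddGroup.lift I.toIdeal.toAddSubgroup (quotientDecomposeAux 𝒜 I).toAddMonoidHom
    (fun a ha => quotientDecomposeAux_of_mem 𝒜 I a ha)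

theorem quotientDecompose_mk (I : HomogeneousIdeal 𝒜) (a : A) :
    quotientDecompose 𝒜 I (Ideal.Quotient.mk I.toIdeal a) = quotientDecomposeAux 𝒜 I a := rfl

instance quotientGrading.decomposition (I : HomogeneousIdeal 𝒜) :
    DirectSum.Decomposition (quotientGrading 𝒜 I) where
  decompose' := quotientDecompose 𝒜 I
  left_inv x := by
    obtain ⟨a, rfl⟩ := Ideal.Quotient.mk_surjective x
    rw [quotientDecompose_mk]
    exact coeLinearMap_quotientDecomposeAux 𝒜 I a
  right_inv x := by
    induction x using DirectSum.induction_on with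
    | zero => rw [map_zero, map_zero]
    | of n x =>
      obtain ⟨_, a, ha, rfl⟩ := x
      rw [DirectSum.coeAddMonoidHom_of]
      exact (quotientDecompose_mk 𝒜 I a).trans (quotientDecomposeAux_homogeneous 𝒜 I n ⟨a, ha⟩)
    | add x y hx hy => rw [map_add, map_add, hx, hy]

instance quotientGrading.gradedAlgebra (I : HomogeneousIdeal 𝒜) :
    GradedAlgebra (quotientGrading 𝒜 I) where

end Quotient

/-! ### The Fano scheme of lines -/

section Fano

open MvPolynomial

variable {K : Type*} [Field K] {σ : Type*} [Fintype σ]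

instance homogeneousSubmodule.gradedAlgebra (τ : Type*) :
    GradedAlgebra (homogeneousSubmodule τ K) := MvPolynomial.gradedAlgebra

/-- The relations between the Plücker coordinates `X (u, v)` of lines in the projective space with
homogeneous coordinates indexed by `σ`: they are alternating and satisfy the three-term quadratic
relations. -/
inductive IsPluckerRelation : MvPolynomial (σ × σ) K → Prop
  | diag (u : σ) : IsPluckerRelation (X (u, u))
  | swap (u v : σ) : IsPluckerRelation (X (u, v) + X (v, u))
  | quad (a b c d : σ) : IsPluckerRelation
      (X (a, b) * X (c, d) - X (a, c) * X (b, d) + X (a, d) * X (b, c))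

variable (K) in
/-- The coordinate with index `u` of the general point `∑ v, X (u, v) * w v` of the line with
Plücker coordinates `X (u, v)`; the parameters `w v` are the outer variables. If the line is
spanned by `x` and `y`, so that `X (u, v) = x u * y v - x v * y u`, this is
`(∑ v, y v * w v) • x - (∑ v, x v * w v) • y`. -/
def generalPoint (u : σ) : MvPolynomial σ (MvPolynomial (σ × σ) K) :=
  ∑ v, C (X (u, v)) * X v

/-- The equations, in the Plücker coordinates, which say that the line is contained in the
projective scheme with ideal `I`: the coefficients of `f` at the general point of the line, for
`f ∈ I`. -/
def incidenceEquations (I : Ideal (MvPolynomial σ K)) : Set (MvPolynomial (σ × σ) K) :=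
  {g | ∃ f ∈ I, ∃ m : σ →₀ ℕ, g = coeff m (aeval (generalPoint K) f)}

theorem coeff_aeval_generalPoint_mem (f : MvPolynomial σ K) (m : σ →₀ ℕ) :
    coeff m (aeval (generalPoint K) f) ∈ homogeneousSubmodule (σ × σ) K m.degree := by
  classical
  induction f using MvPolynomial.induction_on generalizing m with
  | C a =>
    rw [aeval_C, IsScalarTower.algebraMap_apply K (MvPolynomial (σ × σ) K), algebraMap_eq, coeff_C]
    split_ifs with h
    · subst h
      simp
    · exact Submodule.zero_mem _
  | add f g hf hg =>
    rw [map_add, coeff_add]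
    exact Submodule.add_mem _ (hf m) (hg m)
  | mul_X f u hf =>
    rw [map_mul, aeval_X, generalPoint, Finset.mul_sum, coeff_sum]
    refine Submodule.sum_mem _ fun v _ => ?_
    rw [mul_left_comm, coeff_C_mul, coeff_mul_X']
    split_ifs with h
    · have h1 := (isHomogeneous_X K (u, v)).mul (hf (m - Finsupp.single v 1))
      have h2 : 1 + (m - Finsupp.single v 1).degree = m.degree := by
        have h3 : Finsupp.single v 1 ≤ m := by
          rw [Finsupp.single_le_iff]
          exact Nat.one_le_iff_ne_zero.2 (Finsupp.mem_support_iff.1 h)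
        conv_rhs => rw [← add_tsub_cancel_of_le h3, map_add, Finsupp.degree_single]
      rwa [h2] at h1
    · rw [mul_zero]
      exact Submodule.zero_mem _

theorem isHomogeneousElem_of_mem (I : Ideal (MvPolynomial σ K)) (g : MvPolynomial (σ × σ) K)
    (hg : g ∈ {g | IsPluckerRelation g} ∪ incidenceEquations I) :
    SetLike.IsHomogeneousElem (homogeneousSubmodule (σ × σ) K) g := by
  rcases hg with hg | ⟨f, -, m, rfl⟩
  · cases hg with
    | diag u => exact ⟨1, isHomogeneous_X K _⟩
    | swap u v => exact ⟨1, (isHomogeneous_X K _).add (isHomogeneous_X K _)⟩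
    | quad a b c d =>
      have h (q r : σ × σ) : (X q * X r : MvPolynomial (σ × σ) K).IsHomogeneous 2 :=
        (isHomogeneous_X K q).mul (isHomogeneous_X K r)
      exact ⟨2, ((h _ _).sub (h _ _)).add (h _ _)⟩
  · exact ⟨_, coeff_aeval_generalPoint_mem f m⟩

/-- The homogeneous ideal of the Fano scheme of lines in the Plücker coordinates. -/
def fanoIdeal (I : Ideal (MvPolynomial σ K)) : HomogeneousIdeal (homogeneousSubmodule (σ × σ) K) where
  toSubmodule := Ideal.span ({g | IsPluckerRelation g} ∪ incidenceEquations I)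
  is_homogeneous' := Ideal.homogeneous_span _ _ (isHomogeneousElem_of_mem I)

/-- The Fano scheme `F₁(X)` of lines in the projective scheme `X` with ideal `I`, as a closed
subscheme of the Grassmannian of lines in its Plücker embedding. -/
def fanoScheme (I : Ideal (MvPolynomial σ K)) : AlgebraicGeometry.Scheme :=
  AlgebraicGeometry.Proj (quotientGrading (homogeneousSubmodule (σ × σ) K) (fanoIdeal I))

/-- The functor of points of the chart of the Fano scheme where the Plücker coordinate `(i, j)` is
invertible: its points with values in a `K`-algebra `A` are the lines spanned by points `x`, `y`
with coordinates in `A` and with `(x i, x j) = (1, 0)`, `(y i, y j) = (0, 1)`, such that every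
`f ∈ I` vanishes at `s • x + t • y`, where `s = X 0` and `t = X 1` are indeterminates. -/
theorem fanoIdeal_chart (I : Ideal (MvPolynomial σ K)) {A : Type*} [CommRing A] [Algebra K A]
    (p : σ × σ → A) (i j : σ) (hp : p (i, j) = 1) :
    (∀ g ∈ (fanoIdeal I).toIdeal, aeval p g = 0) ↔
      ∃ x y : σ → A, x i = 1 ∧ x j = 0 ∧ y i = 0 ∧ y j = 1 ∧
        (∀ u v, p (u, v) = x u * y v - x v * y u) ∧
        ∀ f ∈ I, aeval (fun u => C (x u) * X 0 + C (y u) * X 1 : σ → MvPolynomial (Fin 2) A) f = 0 := by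
  classical
  -- the specialization of the general point at `p`
  have key (f : MvPolynomial σ K) : map (aeval p : MvPolynomial (σ × σ) K →ₐ[K] A).toRingHom
      (aeval (generalPoint K) f) =
      aeval (fun u => ∑ v, C (p (u, v)) * X v : σ → MvPolynomial σ A) f := by
    induction f using MvPolynomial.induction_on with
    | C a =>
      rw [aeval_C, aeval_C, IsScalarTower.algebraMap_apply K (MvPolynomial (σ × σ) K)
        (MvPolynomial σ (MvPolynomial (σ × σ) K)), algebraMap_eq, map_C,
        IsScalarTower.algebraMap_apply K A (MvPolynomial σ A), algebraMap_eq, algebraMap_eq]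
      exact congrArg C (aeval_C p a)
    | add f g hf hg => simp only [map_add, hf, hg]
    | mul_X f u hf =>
      rw [map_mul, map_mul, map_mul, hf, aeval_X, aeval_X, generalPoint, map_sum]
      simp
  have gen : (∀ g ∈ (fanoIdeal I).toIdeal, aeval p g = 0) ↔
      (∀ g : MvPolynomial (σ × σ) K, IsPluckerRelation g → aeval p g = 0) ∧
      ∀ f ∈ I, aeval (fun u => ∑ v, C (p (u, v)) * X v : σ → MvPolynomial σ A) f = 0 := by
    change Ideal.span _ ≤ RingHom.ker (aeval p : MvPolynomial (σ × σ) K →ₐ[K] A) ↔ _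
    rw [Ideal.span_le, Set.union_subset_iff]
    refine and_congr Iff.rfl ⟨fun h f hf => ?_, ?_⟩
    · ext m
      rw [← key, coeff_map]
      exact h ⟨f, hf, m, rfl⟩
    · rintro h _ ⟨f, hf, m, rfl⟩
      have := congrArg (coeff m) (h f hf)
      rwa [← key, coeff_map] at this
  rw [gen]
  constructor
  · rintro ⟨hP, hI⟩
    have hd (u : σ) : p (u, u) = 0 := by simpa using hP _ (.diag u)
    have hs (u v : σ) : p (v, u) = - p (u, v) := by
      have := hP _ (.swap u v)
      simp only [map_add, aeval_X] at this
      linear_combination this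
    have hq (u v : σ) : p (u, v) = p (u, j) * p (i, v) - p (v, j) * p (i, u) := by
      have := hP _ (.quad u v i j)
      simp only [map_add, map_sub, map_mul, aeval_X, hp] at this
      linear_combination this + p (v, j) * hs i u - p (u, j) * hs i v
    refine ⟨fun u => p (u, j), fun u => p (i, u), hp, hd j, hd i, hp, hq, fun f hf => ?_⟩
    have h := congrArg (aeval (R := A) (Pi.single j (X 0) - Pi.single i (X 1) :
      σ → MvPolynomial (Fin 2) A)) (hI f hf)
    rw [map_zero, ← AlgHom.coe_restrictScalars' K, ← AlgHom.comp_apply, comp_aeval] at h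
    rw [← h]
    congr 2
    ext1 u
    simp [Pi.single_apply, mul_sub, Finset.sum_sub_distrib, hs i u, algebraMap_eq]
  · rintro ⟨x, y, -, -, -, -, hxy, hI⟩
    refine ⟨fun g hg => ?_, fun f hf => ?_⟩
    · cases hg <;> simp [hxy] <;> ring
    · have h := congrArg (aeval (R := A) (![∑ v, C (y v) * X v, - ∑ v, C (x v) * X v] :
        Fin 2 → MvPolynomial σ A)) (hI f hf)
      rw [map_zero, ← AlgHom.coe_restrictScalars' K, ← AlgHom.comp_apply, comp_aeval] at h
      rw [← h]
      congr 2
      ext1 u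
      simp only [hxy, AlgHom.coe_restrictScalars', map_add, map_mul, aeval_X, aeval_C,
        algebraMap_eq, Matrix.cons_val_zero, Matrix.cons_val_one, Finset.mul_sum, mul_neg,
        ← Finset.sum_neg_distrib, ← Finset.sum_add_distrib]
      refine Finset.sum_congr rfl fun v _ => ?_
      simp only [map_sub, map_mul]
      ring

end Fano

/-! ### Toric surfaces -/

/-- The inclusion of the lattice `ℤ²` in `ℝ²`. -/
def latticeInclusion (u : ℤ × ℤ) : ℝ × ℝ := ((u.1 : ℝ), (u.2 : ℝ))

/-- A lattice polygon, that is, a two-dimensional polytope in `ℝ²` with vertices in `ℤ²`. It is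
given by a finite set of lattice points of which it is the convex hull. -/
structure LatticePolygon where
  /-- A finite set of lattice points that contains all the vertices. -/
  points : Finset (ℤ × ℤ)
  interior_nonempty : (interior (convexHull ℝ (latticeInclusion '' (points : Set (ℤ × ℤ))))).Nonempty

namespace LatticePolygon

variable (P : LatticePolygon)

/-- The polygon as a subset of the plane. -/
def toSet : Set (ℝ × ℝ) := convexHull ℝ (latticeInclusion '' (P.points : Set (ℤ × ℤ)))

/-- The set `P ∩ ℤ²`. -/
def latticePoints : Set (ℤ × ℤ) := {u | latticeInclusion u ∈ P.toSet}

theorem finite_latticePoints : P.latticePoints.Finite := by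
  have hb : Bornology.IsBounded P.toSet :=
    isBounded_convexHull.2 (P.points.finite_toSet.image _).isBounded
  obtain ⟨r, hr⟩ := hb.subset_closedBall 0
  refine (Set.finite_Icc (-⌈r⌉, -⌈r⌉) (⌈r⌉, ⌈r⌉)).subset fun u hu => ?_
  have h := hr hu
  rw [mem_closedBall_zero_iff, Prod.norm_def, max_le_iff] at h
  have aux (n : ℤ) (hn : ‖(n : ℝ)‖ ≤ r) : -⌈r⌉ ≤ n ∧ n ≤ ⌈r⌉ := by
    have h1 := abs_le.1 (hn.trans (Int.le_ceil r))
    exact ⟨by exact_mod_cast h1.1, by exact_mod_cast h1.2⟩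
  have h1 := aux u.1 h.1
  have h2 := aux u.2 h.2
  exact ⟨⟨h1.1, h2.1⟩, ⟨h1.2, h2.2⟩⟩

instance : Fintype P.latticePoints := P.finite_latticePoints.fintype

/-- The semigroup `S_P` generated by `(P ∩ ℤ²) × {1}`. (The last coordinate is never negative, so
it is taken in `ℕ`.) -/
def semigroup : AddSubmonoid ((ℤ × ℤ) × ℕ) :=
  AddSubmonoid.closure {z | z.1 ∈ P.latticePoints ∧ z.2 = 1}

/-- The degree on `S_P`, the last coordinate. -/
def degree : P.semigroup →+ ℕ := (AddMonoidHom.snd (ℤ × ℤ) ℕ).comp P.semigroup.subtype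

/-- The projective toric surface `X_P = Proj K[S_P]`. -/
def toricSurface (K : Type*) [Field K] : AlgebraicGeometry.Scheme :=
  AlgebraicGeometry.Proj (AddMonoidAlgebra.gradeBy K P.degree)

/-- The generator `(u, 1)` of `S_P`. -/
def generator (u : P.latticePoints) : P.semigroup :=
  ⟨((u : ℤ × ℤ), 1), AddSubmonoid.subset_closure ⟨u.2, rfl⟩⟩

/-- The homogeneous ideal `I_P` of `X_P` in the projective space with coordinates `x_u`,
`u ∈ P ∩ ℤ²`: the kernel of the surjection `K[x_u] → K[S_P]` which sends `x_u` to `(u, 1)`. -/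
def toricIdeal (K : Type*) [Field K] : Ideal (MvPolynomial P.latticePoints K) :=
  RingHom.ker (MvPolynomial.aeval (R := K)
    (fun u => AddMonoidAlgebra.single (P.generator u) (1 : K)))

/-- The Fano scheme `F₁(X_P)` of lines in `X_P`. -/
def fanoSchemeOfLines (K : Type*) [Field K] : AlgebraicGeometry.Scheme :=
  fanoScheme (P.toricIdeal K)

end LatticePolygon

end FanoToric

end

noncomputable section

namespace FanoToric

open MvPolynomial HomogeneousLocalization

/-! ### Degree zero localizations of graded algebras generated in degree one. -/

section Homogeneous

variable {K B σ : Type*} [CommRing K] [CommRing B] [Algebra K B]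

/-! The Fano scheme is covered by Plücker charts that turn out to be affine spaces of dimension 0, 1
or 2.

Which charts are needed is decided by a degeneration argument. Given a line over any field, choose
`i` lexicographically largest among the lattice points occurring in a nonzero Plücker coordinate,
and then `j` largest with the coordinate `(i, j)` nonzero. The binomial equations of the surface
force the segment from `i` to `j` to be a face of `P` without further lattice points
(`isFace_of_line`, `exists_isFace`).

Non-singularity enters at the torus-fixed points of the endpoints. At such a point the embedding
dimension is at least the number of indecomposable generators of the monoid of `(P ∩ ℤ²) - i`. Three
of these would satisfy a relation in `ℤ²` that lowers the Krull dimension below that number, so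
there are at most two (`card_le_two`). Comparing the bases at `i` and at `j` gives
`FaceCoordinates`: neighbors `k` of `i` and `l` of `j` with `l - i = m (j - i) + (k - i)`.

With parameters `s`, `t` on the line, a line in the chart `(i, j)` has coordinates `ℓ_i = s` and
`ℓ_j = t`. The equation relating `ℓ_l` and `ℓ_k` forces `ℓ_k = s ^ m * γ` with `γ` a form of degree
`1 - m`, and then `ℓ_u = s ^ c u * t ^ a u * γ ^ b u` for all `u`. Hence `γ` is an arbitrary linear
form if `m = 0`, an arbitrary constant if `m = 1`, and zero if `m ≥ 2`; it corresponds to a section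
of the normal bundle `O(1 - m)` of the edge. The argument works over every `K`-algebra, so it
identifies the coordinate ring of the chart with a polynomial ring, nilpotents included
(`exists_chart_ringEquiv`). -/

theorem aeval_mul_of_isHomogeneous (p : σ → B) (c : B) {F : MvPolynomial σ K} {n : ℕ}
    (hF : F.IsHomogeneous n) : aeval (fun u => c * p u) F = c ^ n * aeval p F := by
  rw [aeval_def, aeval_def, eval₂_eq, eval₂_eq, Finset.mul_sum]
  refine Finset.sum_congr rfl fun d hd => ?_
  have h : ∑ i ∈ d.support, d i = n := by
    have := hF (mem_support_iff.1 hd)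
    rwa [Finsupp.weight_apply, Finsupp.sum, Finset.sum_congr rfl (g := d) (by simp)] at this
  simp only [mul_pow, Finset.prod_mul_distrib]
  rw [Finset.prod_pow_eq_pow_sum, h]
  ring

end Homogeneous

section Away

variable {K A : Type*} [Field K] [CommRing A] [Algebra K A] (𝒜 : ℕ → Submodule K A)
  [GradedAlgebra 𝒜]

instance homogeneousLocalizationBaseAlgebra (x : Submonoid A) :
    Algebra K (HomogeneousLocalization 𝒜 x) where
  algebraMap := (fromZeroRingHom 𝒜 x).comp (algebraMap K (𝒜 0))
  commutes' _ _ := mul_comm _ _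
  smul_def' r y := by
    apply val_injective
    rw [val_smul, val_mul, Algebra.smul_def]
    rfl

/-- The inclusion of the degree zero part in the localization. -/
def valAlgHom (x : Submonoid A) : HomogeneousLocalization 𝒜 x →ₐ[K] Localization x where
  __ := algebraMap (HomogeneousLocalization 𝒜 x) (Localization x)
  commutes' _ := rfl

variable {𝒜}

theorem valAlgHom_apply {x : Submonoid A} (y : HomogeneousLocalization 𝒜 x) :
    valAlgHom 𝒜 x y = y.val := rfl

/-- The fraction `a / f` for `a` and `f` of degree one. -/
def fraction {f : A} (hf : f ∈ 𝒜 1) {a : A} (ha : a ∈ 𝒜 1) : Away 𝒜 f :=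
  Away.mk 𝒜 hf 1 a (by simpa using ha)

variable {f : A} (hf : f ∈ 𝒜 1)

theorem val_fraction {a : A} (ha : a ∈ 𝒜 1) :
    (fraction hf ha).val = Localization.Away.invSelf f * algebraMap A _ a := by
  rw [fraction, Away.val_mk, Localization.Away.invSelf, ← Localization.mk_one_eq_algebraMap,
    Localization.mk_mul]
  simp

theorem fraction_self : fraction hf hf = 1 := by
  apply val_injective
  rw [fraction, Away.val_mk, val_one]
  simp only [pow_one]
  exact Localization.mk_self (⟨f, 1, pow_one f⟩ : Submonoid.powers f)

variable {σ : Type*} {a : σ → A} (ha : ∀ u, a u ∈ 𝒜 1)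

theorem val_aeval_fraction {F : MvPolynomial σ K} {n : ℕ} (hF : F.IsHomogeneous n) :
    (aeval (fun u => fraction hf (ha u)) F).val =
      Localization.mk (aeval a F) (⟨f ^ n, n, rfl⟩ : Submonoid.powers f) := by
  rw [← valAlgHom_apply, ← AlgHom.comp_apply, comp_aeval]
  simp only [valAlgHom_apply, val_fraction]
  have h : aeval (fun u => algebraMap A (Localization (Submonoid.powers f)) (a u)) F =
      algebraMap A _ (aeval a F) :=
    (comp_aeval_apply _ (IsScalarTower.toAlgHom K A (Localization (Submonoid.powers f))) F).symm
  rw [aeval_mul_of_isHomogeneous _ _ hF, h, Localization.Away.invSelf, Localization.mk_pow,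
    ← Localization.mk_one_eq_algebraMap, Localization.mk_mul]
  simp

theorem aeval_fraction_eq_zero {F : MvPolynomial σ K} {n : ℕ} (hF : F.IsHomogeneous n)
    (h : aeval a F = 0) : aeval (fun u => fraction hf (ha u)) F = 0 := by
  apply val_injective
  rw [val_aeval_fraction hf ha hF, h, Localization.mk_zero, val_zero]

/-- Evaluation at elements of degree one respects degrees, so the degree `n` component of any
preimage is again a preimage. -/
theorem exists_isHomogeneous_of_mem (ha : ∀ u, a u ∈ 𝒜 1)
    (hs : Function.Surjective (aeval a : MvPolynomial σ K →ₐ[K] A))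
    {n : ℕ} {x : A} (hx : x ∈ 𝒜 n) :
    ∃ F : MvPolynomial σ K, F.IsHomogeneous n ∧ aeval a F = x := by
  obtain ⟨F, rfl⟩ := hs x
  refine ⟨homogeneousComponent n F, homogeneousComponent_isHomogeneous n F, ?_⟩
  have hmem (k : ℕ) : aeval a (homogeneousComponent k F) ∈ 𝒜 k := by
    have hF := homogeneousComponent_isHomogeneous k F
    rw [aeval_def, eval₂_eq]
    refine Submodule.sum_mem _ fun d hd => ?_
    rw [← Algebra.smul_def]
    refine Submodule.smul_mem _ _ ?_
    have h : ∑ i ∈ d.support, d i = k := by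
      have := hF (mem_support_iff.1 hd)
      rwa [Finsupp.weight_apply, Finsupp.sum, Finset.sum_congr rfl (g := d) (by simp)] at this
    rw [← h]
    refine SetLike.prod_mem_graded _ _ _ fun i _ => ?_
    simpa using SetLike.pow_mem_graded (d i) (ha i)
  have h1 : aeval a F = ∑ k ∈ Finset.range (F.totalDegree + 1), aeval a (homogeneousComponent k F) := by
    conv_lhs => rw [← sum_homogeneousComponent F, map_sum]
  have h2 := DirectSum.decompose_of_mem_same 𝒜 hx
  rw [← h2]
  conv_rhs => rw [h1]
  rw [DirectSum.decompose_sum, DFinsupp.finsetSum_apply, Submodule.coe_sum, Finset.sum_eq_single n]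
  · rw [DirectSum.decompose_of_mem_same 𝒜 (hmem n)]
  · intro k _ hk
    exact DirectSum.decompose_of_mem_ne 𝒜 (hmem k) hk
  · intro hn
    rw [homogeneousComponent_eq_zero n F (by simpa using hn)]
    simp

theorem aeval_fraction_surjective
    (hs : Function.Surjective (aeval a : MvPolynomial σ K →ₐ[K] A)) :
    Function.Surjective (aeval (fun u => fraction hf (ha u)) : MvPolynomial σ K →ₐ[K] Away 𝒜 f) := by
  intro x
  obtain ⟨n, x, hx, rfl⟩ := Away.mk_surjective 𝒜 hf x
  obtain ⟨F, hF, rfl⟩ := exists_isHomogeneous_of_mem ha hs (n := n) (by simpa using hx)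
  refine ⟨F, val_injective _ ?_⟩
  rw [val_aeval_fraction hf ha hF, Away.val_mk]

variable {B : Type*} [CommRing B] [Algebra K B]

/-- The homomorphism on the degree zero part of `A_f` induced by a homomorphism that maps `f`
to one. -/
def awayLift (φ : A →ₐ[K] B) (h : φ f = 1) : Away 𝒜 f →ₐ[K] B :=
  (IsLocalization.liftAlgHom (M := Submonoid.powers f) (S := Localization (Submonoid.powers f))
    (f := φ) (by rintro ⟨_, n, rfl⟩; simp [h])).comp (valAlgHom 𝒜 _)

theorem awayLift_fraction (φ : A →ₐ[K] B) (h : φ f = 1) {x : A} (hx : x ∈ 𝒜 1) :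
    awayLift φ h (fraction hf hx) = φ x := by
  rw [awayLift, AlgHom.comp_apply, valAlgHom_apply, fraction, Away.val_mk, Localization.mk_eq_mk']
  erw [IsLocalization.lift_mk'_spec]
  simp [h]

end Away

/-! ### Local rings of Proj on its standard affine charts. -/

section Stalk

open AlgebraicGeometry CategoryTheory

universe u

/-- An open immersion induces isomorphisms of stalks. -/
def stalkEquivOfIsOpenImmersion {X Y : Scheme.{u}} (g : X ⟶ Y) [IsOpenImmersion g] (x : X) :
    Y.presheaf.stalk (g x) ≃+* X.presheaf.stalk x :=
  (asIso (g.stalkMap x)).commRingCatIsoToRingEquiv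

variable {A : Type u} {σ : Type*} [CommRing A] [SetLike σ A] [AddSubgroupClass σ A] (𝒜 : ℕ → σ)
  [GradedRing 𝒜] {f : A} {m : ℕ} (hf : f ∈ 𝒜 m) (hm : 0 < m)

/-- The point of `Proj` which corresponds to a prime ideal of the degree zero part of `A_f`. -/
def pointOfPrime (y : PrimeSpectrum (Away 𝒜 f)) : Proj 𝒜 :=
  Proj.awayι 𝒜 f hf hm (y : Spec (.of (Away 𝒜 f)))

/-- The stalk of `Proj` at a point of a standard affine chart. -/
theorem nonempty_stalk_ringEquiv (y : PrimeSpectrum (Away 𝒜 f)) :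
    Nonempty ((Proj 𝒜).presheaf.stalk (pointOfPrime 𝒜 hf hm y) ≃+*
      Localization.AtPrime y.asIdeal) :=
  ⟨(stalkEquivOfIsOpenImmersion (Proj.awayι 𝒜 f hf hm) y).trans
    (Spec.stalkIso (.of (Away 𝒜 f)) y).commRingCatIsoToRingEquiv⟩

theorem exists_pointOfPrime_eq (x : Proj 𝒜) (hx : f ∉ x.asHomogeneousIdeal) :
    ∃ y : PrimeSpectrum (Away 𝒜 f), pointOfPrime 𝒜 hf hm y = x := by
  have : x ∈ (Proj.awayι 𝒜 f hf hm).opensRange := by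
    rw [Proj.opensRange_awayι]
    exact hx
  exact this

end Stalk

end FanoToric

namespace FanoToric

open MvPolynomial HomogeneousLocalization

/-! ### Linear forms in the two parameters of a line. -/

section LinearForm

variable {A : Type*} [CommRing A]

/-- The linear form `a s + b t` in the indeterminates `s = X 0` and `t = X 1`. -/
def linearForm (a b : A) : MvPolynomial (Fin 2) A := C a * X 0 + C b * X 1

theorem coeff_linearForm_zero (a b : A) : coeff (Finsupp.single 0 1) (linearForm a b) = a := by
  simp [linearForm, coeff_C_mul, coeff_X, Finsupp.single_left_inj]

theorem coeff_linearForm_one (a b : A) : coeff (Finsupp.single 1 1) (linearForm a b) = b := by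
  simp [linearForm, coeff_C_mul, coeff_X, Finsupp.single_left_inj]

theorem linearForm_inj {a b a' b' : A} (h : linearForm a b = linearForm a' b') :
    a = a' ∧ b = b' := by
  refine ⟨?_, ?_⟩
  · rw [← coeff_linearForm_zero a b, h, coeff_linearForm_zero]
  · rw [← coeff_linearForm_one a b, h, coeff_linearForm_one]

theorem exists_eq_linearForm {F : MvPolynomial (Fin 2) A} (hF : F.IsHomogeneous 1) :
    ∃ a b, F = linearForm a b := by
  refine ⟨coeff (Finsupp.single 0 1) F, coeff (Finsupp.single 1 1) F, ?_⟩
  ext d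
  by_cases hd : d.degree = 1
  · have h : d = Finsupp.single 0 1 ∨ d = Finsupp.single 1 1 := by
      rw [Finsupp.degree_eq_sum, Fin.sum_univ_two] at hd
      have : (d 0 = 1 ∧ d 1 = 0) ∨ (d 0 = 0 ∧ d 1 = 1) := by omega
      rcases this with h | h
      · left; ext i; fin_cases i <;> simp [h]
      · right; ext i; fin_cases i <;> simp [h]
    rcases h with rfl | rfl
    · rw [coeff_linearForm_zero]
    · rw [coeff_linearForm_one]
  · have h2 : (linearForm (coeff (Finsupp.single 0 1) F) (coeff (Finsupp.single 1 1) F)).IsHomogeneous 1 :=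
      ((isHomogeneous_X A (0 : Fin 2)).C_mul _).add ((isHomogeneous_X A (1 : Fin 2)).C_mul _)
    rw [hF.coeff_eq_zero hd, h2.coeff_eq_zero hd]

/-- After setting `t = 1`, the left side is divisible by `s ^ (m + 1)`, while the right side is `x₁
s ^ 2 + y₁ s`. Applied to `ℓ_l` and `ℓ_k`, this is what makes `ℓ_k` divisible by `s ^ m`, or zero if
`m ≥ 2`. -/
theorem eq_zero_of_mul_X_pow_eq {A : Type*} [CommRing A] {x₁ y₁ x₂ y₂ : A} {m : ℕ}
    (h : linearForm x₂ y₂ * X 0 ^ (m + 1) = X 1 ^ m * linearForm x₁ y₁ * X 0) :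
    (1 ≤ m → y₁ = 0) ∧ (2 ≤ m → x₁ = 0) := by
  have h1 := congrArg (aeval (R := A) (![Polynomial.X, 1] : Fin 2 → Polynomial A)) h
  simp only [linearForm, map_mul, map_add, map_pow, aeval_X, aeval_C, Matrix.cons_val_zero,
    Matrix.cons_val_one, one_pow, one_mul, mul_one, ← Polynomial.C_eq_algebraMap] at h1
  refine ⟨fun hm => ?_, fun hm => ?_⟩
  · have h2 := congrArg (fun p => Polynomial.coeff p 1) h1
    simp only [Polynomial.coeff_mul_X_pow', Polynomial.coeff_mul_X] at h2
    rw [if_neg (by omega)] at h2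
    simpa using h2.symm
  · have h2 := congrArg (fun p => Polynomial.coeff p 2) h1
    simp only [Polynomial.coeff_mul_X_pow', Polynomial.coeff_mul_X] at h2
    rw [if_neg (by omega)] at h2
    simpa using h2.symm

theorem map_linearForm {A B : Type*} [CommRing A] [CommRing B] (f : A →+* B) (a b : A) :
    MvPolynomial.map f (linearForm a b) = linearForm (f a) (f b) := by
  simp [linearForm]

end LinearForm

/-! ### Charts of the Fano scheme and universal lines. -/

section Chart

variable {K : Type*} [Field K] {σ : Type*} [Fintype σ] (I : Ideal (MvPolynomial σ K))

/-- The homogeneous coordinate ring of the Fano scheme. -/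
abbrev FanoRing : Type _ := MvPolynomial (σ × σ) K ⧸ (fanoIdeal I).toIdeal

/-- The grading of the homogeneous coordinate ring of the Fano scheme. -/
abbrev fanoGrading : ℕ → Submodule K (FanoRing I) :=
  quotientGrading (homogeneousSubmodule (σ × σ) K) (fanoIdeal I)

/-- The Plücker coordinates as elements of the homogeneous coordinate ring. -/
def plucker (q : σ × σ) : FanoRing I := Ideal.Quotient.mk _ (X q)

theorem plucker_mem (q : σ × σ) : plucker I q ∈ fanoGrading I 1 :=
  ⟨X q, isHomogeneous_X K q, rfl⟩

theorem aeval_plucker (g : MvPolynomial (σ × σ) K) :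
    aeval (plucker I) g = Ideal.Quotient.mk _ g := by
  have : (aeval (plucker I) : MvPolynomial (σ × σ) K →ₐ[K] FanoRing I) =
      Ideal.Quotient.mkₐ K _ := by
    ext q
    simp [plucker]
  rw [this]
  rfl

theorem aeval_plucker_surjective :
    Function.Surjective (aeval (plucker I) : MvPolynomial (σ × σ) K →ₐ[K] FanoRing I) := by
  intro x
  obtain ⟨g, rfl⟩ := Ideal.Quotient.mk_surjective x
  exact ⟨g, aeval_plucker I g⟩

/-- The affine coordinate ring of the chart of the Fano scheme where the Plücker coordinate `q` is
invertible. -/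
abbrev FanoChart (q : σ × σ) : Type _ := Away (fanoGrading I) (plucker I q)

/-- The affine Plücker coordinates on a chart of the Fano scheme. -/
def chartPoint (q r : σ × σ) : FanoChart I q := fraction (plucker_mem I q) (plucker_mem I r)

theorem chartPoint_self (q : σ × σ) : chartPoint I q q = 1 := fraction_self _

theorem aeval_chartPoint (q : σ × σ) {g : MvPolynomial (σ × σ) K} (hg : g ∈ (fanoIdeal I).toIdeal) :
    aeval (chartPoint I q) g = 0 := by
  suffices h : (fanoIdeal I).toIdeal ≤
      RingHom.ker (aeval (chartPoint I q) : MvPolynomial (σ × σ) K →ₐ[K] _) from h hg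
  refine Ideal.span_le.2 fun g hg => ?_
  obtain ⟨n, hn⟩ := isHomogeneousElem_of_mem I g hg
  refine aeval_fraction_eq_zero (plucker_mem I q) (plucker_mem I) hn ?_
  rw [aeval_plucker, Ideal.Quotient.eq_zero_iff_mem]
  exact Ideal.subset_span hg

theorem aeval_chartPoint_surjective (q : σ × σ) :
    Function.Surjective (aeval (chartPoint I q) : MvPolynomial (σ × σ) K →ₐ[K] FanoChart I q) :=
  aeval_fraction_surjective (plucker_mem I q) (plucker_mem I) (aeval_plucker_surjective I)

theorem exists_chart_lift (q : σ × σ) {B : Type*} [CommRing B] [Algebra K B] (p : σ × σ → B)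
    (hp : p q = 1) (h : ∀ g ∈ (fanoIdeal I).toIdeal, aeval p g = 0) :
    ∃ φ : FanoChart I q →ₐ[K] B, ∀ r, φ (chartPoint I q r) = p r := by
  let ψ : FanoRing I →ₐ[K] B := Ideal.Quotient.liftₐ _ (aeval p) h
  have hψ (r : σ × σ) : ψ (plucker I r) = p r := aeval_X p r
  exact ⟨awayLift ψ ((hψ q).trans hp), fun r => (awayLift_fraction _ _ _ _).trans (hψ r)⟩

/-- A chart of the Fano scheme is an affine space if it has a universal line. -/
theorem nonempty_fanoChart_ringEquiv {i j : σ} {τ : Type*} {x y : σ → MvPolynomial τ K}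
    (hxi : x i = 1) (hxj : x j = 0) (hyi : y i = 0) (hyj : y j = 1)
    (hI : ∀ f ∈ I, aeval (fun u => linearForm (x u) (y u)) f = 0)
    (w : τ → σ × σ) (hw : ∀ t, x (w t).1 * y (w t).2 - x (w t).2 * y (w t).1 = X t)
    (huniv : ∀ x' y' : σ → FanoChart I (i, j), x' i = 1 → x' j = 0 → y' i = 0 → y' j = 1 →
      (∀ f ∈ I, aeval (fun u => linearForm (x' u) (y' u)) f = 0) →
      ∃ θ : MvPolynomial τ K →ₐ[K] FanoChart I (i, j), ∀ u, x' u = θ (x u) ∧ y' u = θ (y u)) :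
    Nonempty (FanoChart I (i, j) ≃+* MvPolynomial τ K) := by
  let p : σ × σ → MvPolynomial τ K := fun q => x q.1 * y q.2 - x q.2 * y q.1
  have hp : p (i, j) = 1 := by simp [p, hxi, hxj, hyi, hyj]
  obtain ⟨φ, hφ⟩ := exists_chart_lift I (i, j) p hp
    ((fanoIdeal_chart I p i j hp).2 ⟨x, y, hxi, hxj, hyi, hyj, fun _ _ => rfl, hI⟩)
  obtain ⟨x', y', hxi', hxj', hyi', hyj', hp', hI'⟩ := (fanoIdeal_chart I (chartPoint I (i, j)) i j
    (chartPoint_self I _)).1 fun g hg => aeval_chartPoint I _ hg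
  obtain ⟨θ, hθ⟩ := huniv x' y' hxi' hxj' hyi' hyj' hI'
  have hθp (q : σ × σ) : θ (p q) = chartPoint I (i, j) q := by
    rw [show q = (q.1, q.2) from rfl, hp']
    simp only [p, map_sub, map_mul, hθ]
  -- Each variable is itself a Plücker coordinate of the universal line, by `hw`, and both maps
  -- preserve Plücker coordinates.
  have hφθ : φ.comp θ = AlgHom.id K _ := by
    ext1 t
    rw [AlgHom.comp_apply, ← hw t]
    exact (congrArg φ (hθp (w t))).trans (hφ _)
  have hinj : Function.Injective θ :=
    Function.LeftInverse.injective (g := φ) fun b => DFunLike.congr_fun hφθ b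
  have hsurj : Function.Surjective θ := by
    intro b
    obtain ⟨g, rfl⟩ := aeval_chartPoint_surjective I (i, j) b
    refine ⟨aeval p g, ?_⟩
    rw [comp_aeval_apply]
    simp only [hθp]
  exact ⟨(RingEquiv.ofBijective θ ⟨hinj, hsurj⟩).symm⟩

end Chart

end FanoToric

namespace FanoToric

open MvPolynomial HomogeneousLocalization

/-! ### Binomial equations of the toric surface, and the face attached to a line. -/

namespace LatticePolygon

variable (P : LatticePolygon) (K : Type*) [Field K]

/-- The element `∑ n u • (u, 1)` of the semigroup `S_P`. -/
abbrev genSum : (P.latticePoints →₀ ℕ) →ₗ[ℕ] P.semigroup :=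
  Finsupp.linearCombination ℕ P.generator

theorem degree_genSum (n : P.latticePoints →₀ ℕ) : P.degree (P.genSum n) = n.degree := by
  rw [genSum, Finsupp.linearCombination_apply, Finsupp.sum, map_sum, Finsupp.degree_apply]
  simp [degree, generator]

/-- The underlying lattice point of an element of `S_P`. -/
def position : P.semigroup →+ ℤ × ℤ := (AddMonoidHom.fst (ℤ × ℤ) ℕ).comp P.semigroup.subtype

theorem position_generator (u : P.latticePoints) : P.position (P.generator u) = u := rfl

theorem degree_generator (u : P.latticePoints) : P.degree (P.generator u) = 1 := rfl

variable {P} in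
theorem semigroup_ext {s t : P.semigroup} (h1 : P.position s = P.position t)
    (h2 : P.degree s = P.degree t) : s = t :=
  Subtype.ext (Prod.ext h1 h2)

theorem position_genSum (n : P.latticePoints →₀ ℕ) :
    P.position (P.genSum n) = n.sum fun u k => k • (u : ℤ × ℤ) := by
  rw [genSum, Finsupp.linearCombination_apply, Finsupp.sum, map_sum]
  simp [position_generator, Finsupp.sum]

theorem aeval_monomial_generator (n : P.latticePoints →₀ ℕ) :
    aeval (R := K) (fun u => AddMonoidAlgebra.single (P.generator u) (1 : K)) (monomial n 1) =
      AddMonoidAlgebra.single (P.genSum n) 1 := by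
  rw [aeval_monomial, map_one, one_mul, genSum, Finsupp.linearCombination_apply, Finsupp.sum,
    Finsupp.prod]
  simp only [AddMonoidAlgebra.single_pow, one_pow]
  exact (map_prod (AddMonoidAlgebra.of K P.semigroup)
    (fun u => Multiplicative.ofAdd (n u • P.generator u)) n.support).symm

theorem genSum_surjective : Function.Surjective P.genSum := by
  intro ⟨s, hs⟩
  induction hs using AddSubmonoid.closure_induction with
  | mem z hz =>
    refine ⟨Finsupp.single ⟨z.1, hz.1⟩ 1, ?_⟩
    rw [genSum, Finsupp.linearCombination_single, one_smul]
    exact Subtype.ext (Prod.ext rfl hz.2.symm)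
  | zero => exact ⟨0, map_zero _⟩
  | add s t hs ht h1 h2 =>
    obtain ⟨n, hn⟩ := h1
    obtain ⟨m, hm⟩ := h2
    exact ⟨n + m, by rw [map_add, hn, hm]; rfl⟩

theorem aeval_generator_surjective : Function.Surjective
    (aeval (R := K) (fun u => AddMonoidAlgebra.single (P.generator u) (1 : K)) :
      MvPolynomial P.latticePoints K →ₐ[K] AddMonoidAlgebra K P.semigroup) := by
  intro x
  induction x using AddMonoidAlgebra.induction_linear with
  | zero => exact ⟨0, map_zero _⟩
  | add x y hx hy =>
    obtain ⟨f, rfl⟩ := hx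
    obtain ⟨g, rfl⟩ := hy
    exact ⟨f + g, map_add _ _ _⟩
  | single s r =>
    obtain ⟨n, rfl⟩ := P.genSum_surjective s
    refine ⟨r • monomial n 1, ?_⟩
    rw [map_smul, aeval_monomial_generator, AddMonoidAlgebra.smul_single, smul_eq_mul, mul_one]

variable {P K}

/-- The difference of two monomials with the same image in `S_P` lies in the toric ideal. These
binomials are the only equations used from here on. -/
theorem prod_eq_of_genSum_eq {T : Type*} [CommRing T] [Algebra K T] {ℓ : P.latticePoints → T}
    (hℓ : ∀ f ∈ P.toricIdeal K, aeval ℓ f = 0) {n m : P.latticePoints →₀ ℕ}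
    (h : P.genSum n = P.genSum m) : (n.prod fun u k => ℓ u ^ k) = m.prod fun u k => ℓ u ^ k := by
  have h1 : (monomial n 1 - monomial m 1 : MvPolynomial P.latticePoints K) ∈ P.toricIdeal K := by
    rw [toricIdeal, RingHom.mem_ker, map_sub, aeval_monomial_generator, aeval_monomial_generator,
      h, sub_self]
  have h2 := hℓ _ h1
  rw [map_sub, aeval_monomial, aeval_monomial, map_one, one_mul, one_mul] at h2
  exact sub_eq_zero.1 h2

/-- The segment with endpoints `i` and `j` is a face of `P` that contains no other lattice
points. -/
def IsFace (i j : P.latticePoints) : Prop :=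
  i ≠ j ∧ ∀ (n : P.latticePoints →₀ ℕ) (a b : ℕ),
    P.genSum n = a • P.generator i + b • P.generator j → ∀ u, n u ≠ 0 → u = i ∨ u = j

theorem IsFace.symm {i j : P.latticePoints} (h : IsFace i j) : IsFace j i :=
  ⟨h.1.symm, fun n a b hn u hu => (h.2 n b a (hn.trans (add_comm _ _)) u hu).symm⟩

/-- The lexicographic order on the lattice points of `P`. -/
def lexWeight (u : P.latticePoints) : Lex (ℤ × ℤ) := toLex (u : ℤ × ℤ)

theorem lexWeight_injective : Function.Injective (lexWeight (P := P)) :=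
  fun _ _ h => Subtype.ext (toLex.injective h)

/-- In a relation between lattice points and `i`, `j`, the number of factors and the degree in the
parameter are both fixed. Maximality of `i` and `j` bounds each weight by that of `i` or `j`
according to the degree of `ℓ u`. The weights add up to the total bound, so every bound is attained.
-/
theorem isFace_of_line {F : Type*} [Field F] [Algebra K F] {x y : P.latticePoints → F}
    {i j : P.latticePoints} (hxi : x i = 1) (hxj : x j = 0) (hyi : y i = 0) (hyj : y j = 1)
    (hI : ∀ f ∈ P.toricIdeal K, aeval (fun u => linearForm (x u) (y u)) f = 0)
    (hi : ∀ u, x u ≠ 0 ∨ y u ≠ 0 → lexWeight u ≤ lexWeight i)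
    (hj : ∀ u, y u ≠ 0 → lexWeight u ≤ lexWeight j) : IsFace i j := by
  classical
  have hij : i ≠ j := by
    rintro rfl
    exact one_ne_zero (hxi.symm.trans hxj)
  refine ⟨hij, fun n a b hn => ?_⟩
  -- dehomogenize
  let ℓ (u : P.latticePoints) : Polynomial F := Polynomial.C (x u) + Polynomial.C (y u) * Polynomial.X
  have hℓ : ∀ f ∈ P.toricIdeal K, aeval ℓ f = 0 := by
    intro f hf
    have h := congrArg (aeval (R := F) (![1, Polynomial.X] : Fin 2 → Polynomial F)) (hI f hf)
    rw [map_zero, ← AlgHom.coe_restrictScalars' K, comp_aeval_apply] at h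
    rw [← h]
    congr 2
    ext1 u
    simp [ℓ, linearForm, Polynomial.C_eq_algebraMap]
  have hprod : (n.prod fun u k => ℓ u ^ k) = Polynomial.X ^ b := by
    have h : P.genSum n = P.genSum (Finsupp.single i a + Finsupp.single j b) := by
      rw [hn, map_add, genSum, Finsupp.linearCombination_single, Finsupp.linearCombination_single]
    rw [prod_eq_of_genSum_eq hℓ h, Finsupp.prod_add_index' (by simp) (by simp [pow_add]),
      Finsupp.prod_single_index (by simp), Finsupp.prod_single_index (by simp)]
    simp [ℓ, hxi, hxj, hyi, hyj]
  have hne (u : P.latticePoints) (hu : u ∈ n.support) : ℓ u ≠ 0 := by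
    intro h0
    have : (n.prod fun u k => ℓ u ^ k) = 0 :=
      Finset.prod_eq_zero hu (by
        change ℓ u ^ n u = 0
        rw [h0, zero_pow (Finsupp.mem_support_iff.1 hu)])
    rw [hprod] at this
    exact pow_ne_zero b Polynomial.X_ne_zero this
  have hdeg : ∑ u ∈ n.support, n u * (ℓ u).natDegree = b := by
    have h := congrArg Polynomial.natDegree hprod
    rw [Finsupp.prod, Polynomial.natDegree_prod _ _ fun u hu => pow_ne_zero _ (hne u hu)] at h
    simpa using h
  have hcard : ∑ u ∈ n.support, n u = a + b := by
    have h := congrArg P.degree hn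
    rw [degree_genSum] at h
    simpa [degree_generator, Finsupp.degree_apply] using h
  have hpos : ∑ u ∈ n.support, n u • lexWeight u = a • lexWeight i + b • lexWeight j := by
    have h := congrArg P.position hn
    rw [position_genSum, map_add, map_nsmul, map_nsmul] at h
    have h := congrArg (toLexAddEquiv (ℤ × ℤ)) h
    rw [Finsupp.sum, map_sum, map_add, map_nsmul, map_nsmul] at h
    exact h
  -- The bound interpolates: it is the weight of `i` if `ℓ u` has degree 0 and the weight of `j` if
  -- it has degree 1.
  have hle : ∀ u ∈ n.support, n u • lexWeight u ≤
      n u • (lexWeight i + (ℓ u).natDegree • (lexWeight j - lexWeight i)) := by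
    intro u hu
    refine nsmul_le_nsmul_right ?_ _
    by_cases hy : y u = 0
    · have h1 : (ℓ u).natDegree = 0 := by simp [ℓ, hy]
      rw [h1, zero_smul, add_zero]
      refine hi u (Or.inl fun hx => hne u hu ?_)
      simp [ℓ, hx, hy]
    · have h1 : (ℓ u).natDegree = 1 := by
        rw [show ℓ u = Polynomial.C (y u) * Polynomial.X + Polynomial.C (x u) from add_comm _ _]
        exact Polynomial.natDegree_linear hy
      rw [h1, one_smul, add_sub_cancel]
      exact hj u hy
  have heq := (Finset.sum_eq_sum_iff_of_le hle).1 <| by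
    rw [hpos]
    simp only [nsmul_add, Finset.sum_add_distrib, ← mul_nsmul']
    rw [Finset.sum_nsmul_assoc, Finset.sum_nsmul_assoc]
    rw [hcard, hdeg, add_nsmul, nsmul_sub]
    abel
  intro u hu
  have h := nsmul_right_injective hu (heq u (Finsupp.mem_support_iff.2 hu))
  have hd : (ℓ u).natDegree = 0 ∨ (ℓ u).natDegree = 1 := by
    have : (ℓ u).natDegree ≤ 1 := by
      rw [show ℓ u = Polynomial.C (y u) * Polynomial.X + Polynomial.C (x u) from add_comm _ _]
      exact Polynomial.natDegree_linear_le
    omega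
  rcases hd with hd | hd
  · left
    apply lexWeight_injective
    rw [h, hd, zero_smul, add_zero]
  · right
    apply lexWeight_injective
    rw [h, hd, one_smul, add_sub_cancel]

/-- A point of the Fano scheme over a field lies in the chart of a face. -/
theorem exists_isFace {F : Type*} [Field F] [Algebra K F]
    {p : P.latticePoints × P.latticePoints → F}
    (hp : ∀ g ∈ (fanoIdeal (P.toricIdeal K)).toIdeal, aeval p g = 0) (hp0 : ∃ q, p q ≠ 0) :
    ∃ i j, p (i, j) ≠ 0 ∧ IsFace i j := by
  classical
  obtain ⟨i, hi, himax⟩ := Finset.exists_max_image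
    (Finset.univ.filter fun u : P.latticePoints => ∃ v, p (u, v) ≠ 0) lexWeight <| by
      obtain ⟨⟨u, v⟩, h⟩ := hp0
      exact ⟨u, Finset.mem_filter.2 ⟨Finset.mem_univ _, v, h⟩⟩
  obtain ⟨j, hj, hjmax⟩ := Finset.exists_max_image
    (Finset.univ.filter fun v : P.latticePoints => p (i, v) ≠ 0) lexWeight <| by
      obtain ⟨v, h⟩ := (Finset.mem_filter.1 hi).2
      exact ⟨v, by simpa using h⟩
  have hj := (Finset.mem_filter.1 hj).2
  refine ⟨i, j, hj, ?_⟩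
  -- The equations are homogeneous, so the Plücker vector may be rescaled to have coordinate 1 at
  -- `(i, j)`, as the description of the chart requires.
  have hc : ∀ g ∈ (fanoIdeal (P.toricIdeal K)).toIdeal,
      aeval (fun q => (p (i, j))⁻¹ * p q) g = 0 := by
    suffices h : (fanoIdeal (P.toricIdeal K)).toIdeal ≤ RingHom.ker (aeval
      (fun q => (p (i, j))⁻¹ * p q) : MvPolynomial (P.latticePoints × P.latticePoints) K →ₐ[K] F)
      from h
    refine Ideal.span_le.2 fun g hg => ?_
    obtain ⟨n, hn⟩ := isHomogeneousElem_of_mem _ g hg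
    change aeval _ g = 0
    rw [aeval_mul_of_isHomogeneous _ _ hn, hp g (Ideal.subset_span hg), mul_zero]
  obtain ⟨x, y, hxi, hxj, hyi, hyj, hxy, hI⟩ :=
    (fanoIdeal_chart _ _ i j (inv_mul_cancel₀ hj)).1 hc
  have hne {u v : P.latticePoints} (h : x u * y v - x v * y u ≠ 0) : p (u, v) ≠ 0 := by
    rw [← hxy] at h
    exact right_ne_zero_of_mul h
  refine isFace_of_line hxi hxj hyi hyj hI (fun u hu => himax u ?_) fun u hu => hjmax u ?_
  · rw [Finset.mem_filter]
    refine ⟨Finset.mem_univ _, ?_⟩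
    rcases hu with hu | hu
    · exact ⟨j, hne (by simpa [hxj, hyj] using hu)⟩
    · exact ⟨i, hne (by simpa [hxi, hyi] using hu)⟩
  · rw [Finset.mem_filter]
    exact ⟨Finset.mem_univ _, hne (by simpa [hxi, hyi] using hu)⟩

end LatticePolygon

/-! ### The charts of faces cover the Fano scheme. -/

section Cover

variable {K : Type*} [Field K] {σ : Type*} [Fintype σ] (I : Ideal (MvPolynomial σ K))

theorem exists_plucker_notMem (x : fanoScheme I) :
    ∃ q, plucker I q ∉ (x : ProjectiveSpectrum (fanoGrading I)).asHomogeneousIdeal := by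
  have h := AlgebraicGeometry.Proj.iSup_basicOpen_eq_top' (fanoGrading I) (plucker I)
    (fun q => ⟨1, plucker_mem I q⟩) <| by
      rw [eq_top_iff]
      intro a _
      obtain ⟨g, rfl⟩ := aeval_plucker_surjective I a
      induction g using MvPolynomial.induction_on with
      | C r =>
        rw [aeval_C]
        exact Subalgebra.algebraMap_mem _ (algebraMap K (fanoGrading I 0) r)
      | add f g hf hg =>
        rw [map_add]
        exact add_mem (hf trivial) (hg trivial)
      | mul_X f q hf =>
        rw [map_mul, aeval_X]
        exact mul_mem (hf trivial) (Algebra.subset_adjoin ⟨q, rfl⟩)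
  have hx : x ∈ (⊤ : (AlgebraicGeometry.Proj (fanoGrading I)).Opens) := trivial
  rw [← h] at hx
  exact TopologicalSpace.Opens.mem_iSup.1 hx

end Cover

namespace LatticePolygon

variable {P : LatticePolygon} {K : Type*} [Field K]

theorem exists_isFace_chart (x : P.fanoSchemeOfLines K) :
    ∃ i j, IsFace i j ∧ plucker (P.toricIdeal K) (i, j) ∉
      (x : ProjectiveSpectrum (fanoGrading (P.toricIdeal K))).asHomogeneousIdeal := by
  obtain ⟨q, hq⟩ := exists_plucker_notMem _ x
  let 𝔭 := (x : ProjectiveSpectrum (fanoGrading (P.toricIdeal K))).asHomogeneousIdeal.toIdeal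
  have h𝔭 : 𝔭.IsPrime := (x : ProjectiveSpectrum (fanoGrading (P.toricIdeal K))).isPrime
  -- An arbitrary point, closed or not, becomes a line over the fraction field of the coordinate
  -- ring modulo its prime. Being a face does not depend on that field.
  let φ : FanoRing (P.toricIdeal K) →ₐ[K] FractionRing (FanoRing (P.toricIdeal K) ⧸ 𝔭) :=
    (IsScalarTower.toAlgHom K (FanoRing (P.toricIdeal K) ⧸ 𝔭) _).comp (Ideal.Quotient.mkₐ K 𝔭)
  have hφ (a : FanoRing (P.toricIdeal K)) : φ a ≠ 0 ↔ a ∉ 𝔭 := by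
    rw [not_iff_not, ← Ideal.Quotient.eq_zero_iff_mem]
    exact map_eq_zero_iff _ (IsFractionRing.injective (FanoRing (P.toricIdeal K) ⧸ 𝔭) _)
  obtain ⟨i, j, hij, h⟩ := exists_isFace (K := K) (P := P) (p := fun q => φ (plucker _ q))
    (fun g hg => by
      rw [← comp_aeval_apply, aeval_plucker, Ideal.Quotient.eq_zero_iff_mem.2 hg, map_zero])
    ⟨q, (hφ _).2 hq⟩
  exact ⟨i, j, h, (hφ _).1 hij⟩

end LatticePolygon

end FanoToric

namespace FanoToric

/-! ### Sharp monoids and their indecomposable elements. -/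

section Monoid

variable {G : Type*} [AddCommGroup G]

/-- An additive submonoid without non-trivial units. -/
def IsSharp (M : AddSubmonoid G) : Prop := ∀ x ∈ M, ∀ y ∈ M, x + y = 0 → x = 0

/-- An element of a sharp submonoid which is not a sum of two non-zero elements. -/
def IsIndecomposable (M : AddSubmonoid G) (e : G) : Prop :=
  e ≠ 0 ∧ ∀ x ∈ M, ∀ y ∈ M, x + y = e → x = 0 ∨ y = 0

theorem IsIndecomposable.mem_of_mem_closure {S : Set G} {e : G}
    (h : IsIndecomposable (AddSubmonoid.closure S) e) (he : e ∈ AddSubmonoid.closure S) : e ∈ S := by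
  induction he using AddSubmonoid.closure_induction with
  | mem x hx => exact hx
  | zero => exact absurd rfl h.1
  | add x y hx hy h1 h2 =>
    rcases h.2 x hx y hy rfl with rfl | rfl
    · rw [zero_add] at h ⊢
      exact h2 h
    · rw [add_zero] at h ⊢
      exact h1 h

/-- A finitely generated sharp submonoid is generated by indecomposable elements. -/
theorem exists_finset_isIndecomposable {ι : Type*} [Finite ι] (v : ι → G)
    (hM : IsSharp (AddSubmonoid.closure (Set.range v))) :
    ∃ E : Finset ι, AddSubmonoid.closure (v '' E) = AddSubmonoid.closure (Set.range v) ∧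
      ∀ e ∈ E, IsIndecomposable (AddSubmonoid.closure (Set.range v)) (v e) := by
  classical
  have := Fintype.ofFinite ι
  -- A generating set of least cardinality consists of indecomposables, because none of its elements
  -- lies in the monoid generated by the others.
  obtain ⟨E, hE, hmin⟩ := Finset.exists_min_image (Finset.univ.filter fun E : Finset ι =>
    AddSubmonoid.closure (v '' E) = AddSubmonoid.closure (Set.range v)) Finset.card
    ⟨Finset.univ, by simp⟩
  have hE := (Finset.mem_filter.1 hE).2
  have hnot (e : ι) (he : e ∈ E) : v e ∉ AddSubmonoid.closure (v '' (E.erase e : Finset ι)) := by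
    intro h
    have h1 : AddSubmonoid.closure (v '' (E.erase e : Finset ι)) =
        AddSubmonoid.closure (Set.range v) := by
      rw [← hE]
      refine le_antisymm (AddSubmonoid.closure_mono (Set.image_mono (E.erase_subset e))) ?_
      rw [AddSubmonoid.closure_le]
      rintro _ ⟨f, hf, rfl⟩
      by_cases hfe : f = e
      · exact hfe ▸ h
      · exact AddSubmonoid.subset_closure ⟨f, Finset.mem_erase.2 ⟨hfe, hf⟩, rfl⟩
    have h2 := hmin (E.erase e) (Finset.mem_filter.2 ⟨Finset.mem_univ _, h1⟩)
    exact absurd (Finset.card_erase_lt_of_mem he) (not_lt.2 h2)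
  refine ⟨E, hE, fun e he => ⟨fun h0 => hnot e he ?_, ?_⟩⟩
  · rw [h0]
    exact zero_mem _
  · have hle : AddSubmonoid.closure (v '' (E.erase e : Finset ι)) ≤
        AddSubmonoid.closure (Set.range v) :=
      AddSubmonoid.closure_mono (Set.image_subset_range _ _)
    have hv : v e ∈ AddSubmonoid.closure (Set.range v) := AddSubmonoid.subset_closure ⟨e, rfl⟩
    have hdec (x : G) (hx : x ∈ AddSubmonoid.closure (Set.range v)) :
        ∃ (a : ℕ) (x' : G), x' ∈ AddSubmonoid.closure (v '' (E.erase e : Finset ι)) ∧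
          x = a • v e + x' := by
      have h1 : v '' E = {v e} ∪ v '' (E.erase e : Finset ι) := by
        rw [Set.singleton_union, ← Set.image_insert_eq, ← Finset.coe_insert,
          Finset.insert_erase he]
      rw [← hE, h1, AddSubmonoid.closure_union, AddSubmonoid.mem_sup] at hx
      obtain ⟨y, hy, z, hz, rfl⟩ := hx
      obtain ⟨a, rfl⟩ := AddSubmonoid.mem_closure_singleton.1 hy
      exact ⟨a, z, hz, rfl⟩
    intro x hx y hy hxy
    obtain ⟨a, x', hx', rfl⟩ := hdec x hx
    obtain ⟨b, y', hy', rfl⟩ := hdec y hy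
    rcases Nat.eq_zero_or_pos (a + b) with hab | hab
    · obtain ⟨rfl, rfl⟩ := Nat.add_eq_zero_iff.1 hab
      refine absurd (add_mem hx' hy') ?_
      simp only [zero_smul, zero_add] at hxy
      rw [hxy]
      exact hnot e he
    · obtain ⟨c, hc⟩ := Nat.exists_eq_add_of_lt hab
      rw [zero_add] at hc
      have h0 : x' + (c • v e + y') = 0 := by
        have h1 : (a + b) • v e + (x' + y') = v e := by
          refine Eq.trans ?_ hxy
          rw [add_smul]
          abel
        rw [hc, add_smul, one_smul] at h1
        have h2 : c • v e + v e + (x' + y') = (x' + (c • v e + y')) + v e := by abel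
        rw [h2] at h1
        simpa using h1
      have hx0 := hM x' (hle hx') _ (add_mem (nsmul_mem hv c) (hle hy')) h0
      rw [hx0, zero_add] at h0
      have hc0 := hM _ (nsmul_mem hv c) y' (hle hy') h0
      rw [hc0, zero_add] at h0
      rw [hx0, h0, add_zero, add_zero]
      rcases Nat.eq_zero_or_pos a with rfl | ha
      · left; rw [zero_smul]
      rcases Nat.eq_zero_or_pos b with rfl | hb
      · right; rw [zero_smul]
      -- With `a` and `b` both positive, `c • v e = 0` has `c ≥ 1`. Sharpness then gives `v e = 0`,
      -- which lies in the monoid generated by the other elements.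
      exfalso
      refine hnot e he ?_
      have hc1 : 1 ≤ c := by omega
      obtain ⟨d, rfl⟩ := Nat.exists_eq_add_of_le hc1
      rw [add_smul, one_smul] at hc0
      rw [hM _ hv _ (nsmul_mem hv d) hc0]
      exact zero_mem _

/-- Three vectors in `ℤ²` are linearly dependent, and `hv` excludes relations whose coefficients all
have one sign. Up to a global sign, exactly one of the three coefficients is then positive; its
vector is moved to one side. -/
theorem exists_nsmul_eq_of_three (v : Fin 3 → ℤ × ℤ)
    (hv : ∀ a : Fin 3 → ℕ, ∑ l, a l • v l = 0 → a = 0) :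
    ∃ (k : Fin 3) (c : ℕ) (a : Fin 3 → ℕ), c ≠ 0 ∧ a k = 0 ∧ c • v k = ∑ l, a l • v l := by
  have hdep : ¬ LinearIndependent ℤ v := by
    intro h
    have := h.fintype_card_le_finrank
    simp at this
  obtain ⟨g, hg, hne⟩ := Fintype.not_linearIndependent_iff.1 hdep
  have key (g : Fin 3 → ℤ) (hg : ∑ l, g l • v l = 0) (k : Fin 3) (hk : 0 < g k)
      (hl : ∀ l, l ≠ k → g l ≤ 0) :
      ∃ (k : Fin 3) (c : ℕ) (a : Fin 3 → ℕ), c ≠ 0 ∧ a k = 0 ∧ c • v k = ∑ l, a l • v l := by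
    refine ⟨k, (g k).toNat, fun l => (- g l).toNat, by omega, by simp; omega, ?_⟩
    have h1 : ∑ l, g l • v l = (g k).toNat • v k - ∑ l, (- g l).toNat • v l := by
      rw [← Finset.add_sum_erase _ _ (Finset.mem_univ k),
        ← Finset.add_sum_erase Finset.univ (fun l => (- g l).toNat • v l) (Finset.mem_univ k),
        show (- g k).toNat = 0 by omega, zero_smul, zero_add, sub_eq_add_neg,
        ← Finset.sum_neg_distrib]
      congr 1
      · rw [← natCast_zsmul, Int.toNat_of_nonneg hk.le]
      · refine Finset.sum_congr rfl fun l hlk => ?_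
        have := hl l (Finset.ne_of_mem_erase hlk)
        rw [← natCast_zsmul, Int.toNat_of_nonneg (by omega), neg_smul, neg_neg]
    rw [hg] at h1
    exact (sub_eq_zero.1 h1.symm)
  have key2 (g : Fin 3 → ℤ) (hg : ∑ l, g l • v l = 0) (h : ∀ l, 0 ≤ g l) : ∀ l, g l = 0 := by
    have h1 : (fun l => (g l).toNat) = 0 := by
      refine hv _ ?_
      rw [← hg]
      refine Finset.sum_congr rfl fun l _ => ?_
      rw [← natCast_zsmul, Int.toNat_of_nonneg (h l)]
    intro l
    have := congrFun h1 l
    have := h l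
    simp at *
    omega
  have hneg : ∑ l, (- g l) • v l = 0 := by
    simp only [neg_smul, Finset.sum_neg_distrib, hg, neg_zero]
  have hcase : (∃ k, 0 < g k ∧ ∀ l, l ≠ k → g l ≤ 0) ∨ (∃ k, 0 < - g k ∧ ∀ l, l ≠ k → - g l ≤ 0) ∨
      (∀ l, 0 ≤ g l) ∨ ∀ l, 0 ≤ - g l := by
    simp only [Fin.exists_fin_succ, Fin.forall_fin_succ]
    simp
    omega
  obtain ⟨l, hl⟩ := hne
  rcases hcase with ⟨k, hk, h⟩ | ⟨k, hk, h⟩ | h | h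
  · exact key g hg k hk h
  · exact key _ hneg k hk h
  · exact absurd (key2 g hg h l) hl
  · exact absurd (neg_eq_zero.1 (key2 _ hneg h l)) hl

end Monoid

/-! ### The monoid of a polygon at an endpoint of a face. -/

namespace LatticePolygon

variable {P : LatticePolygon}

/-- The position of a lattice point relative to another one. -/
def offset (i u : P.latticePoints) : ℤ × ℤ := (u : ℤ × ℤ) - i

theorem offset_self (i : P.latticePoints) : offset i i = 0 := sub_self _

theorem offset_injective (i : P.latticePoints) : Function.Injective (offset i) :=
  fun _ _ h => Subtype.ext (sub_left_injective h)

/-- The monoid generated by `(P ∩ ℤ²) - i`. -/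
def vertexMonoid (i : P.latticePoints) : AddSubmonoid (ℤ × ℤ) :=
  AddSubmonoid.closure (Set.range (offset i))

theorem offset_mem (i u : P.latticePoints) : offset i u ∈ vertexMonoid i :=
  AddSubmonoid.subset_closure ⟨u, rfl⟩

theorem exists_sum_offset_of_mem_closure {i : P.latticePoints} {E : Set P.latticePoints}
    {z : ℤ × ℤ} (hz : z ∈ AddSubmonoid.closure (offset i '' E)) :
    ∃ n : P.latticePoints →₀ ℕ, (∀ u, n u ≠ 0 → u ∈ E) ∧ (n.sum fun u k => k • offset i u) = z := by
  classical
  induction hz using AddSubmonoid.closure_induction with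
  | mem z hz =>
    obtain ⟨u, hu, rfl⟩ := hz
    refine ⟨Finsupp.single u 1, fun v hv => ?_, by simp⟩
    rw [Finsupp.single_apply] at hv
    exact (ne_eq _ _ ▸ ite_ne_right_iff.1 hv).1 ▸ hu
  | zero => exact ⟨0, by simp, by simp⟩
  | add x y _ _ hx hy =>
    obtain ⟨n, hn, rfl⟩ := hx
    obtain ⟨m, hm, rfl⟩ := hy
    refine ⟨n + m, fun u hu => ?_, Finsupp.sum_add_index' (by simp) (by simp [add_smul])⟩
    by_contra h
    refine hu ?_
    rw [Finsupp.add_apply, not_not.1 (mt (hn u) h), not_not.1 (mt (hm u) h)]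

theorem sum_offset (i : P.latticePoints) (n : P.latticePoints →₀ ℕ) :
    (n.sum fun u k => k • offset i u) =
      P.position (P.genSum n) - n.degree • (i : ℤ × ℤ) := by
  rw [position_genSum, Finsupp.degree_apply, Finsupp.sum, Finsupp.sum, Finset.sum_smul,
    ← Finset.sum_sub_distrib]
  simp only [offset, smul_sub]

/-- Offsets forget the degree, so a relation between them lifts to `S_P` once both sides are padded
with copies of `i` to the same degree. -/
theorem genSum_add_single_eq (i : P.latticePoints) {n m : P.latticePoints →₀ ℕ}
    (h : (n.sum fun u k => k • offset i u) = m.sum fun u k => k • offset i u) :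
    P.genSum (n + Finsupp.single i m.degree) = P.genSum (m + Finsupp.single i n.degree) := by
  rw [sum_offset, sum_offset] at h
  apply semigroup_ext
  · rw [map_add, map_add, map_add, map_add, genSum, Finsupp.linearCombination_single,
      Finsupp.linearCombination_single, map_nsmul, map_nsmul, position_generator]
    linear_combination (exp := 1) h
  · rw [degree_genSum, degree_genSum, map_add, map_add, Finsupp.degree_single,
      Finsupp.degree_single, add_comm]

/-- Padded with copies of `i`, the relation lifts to `S_P` with its right side on the face. Only `i`
and `j` can then occur on the left, and `i` has offset zero. Sharpness is the case `b = 0`,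
indecomposability of `offset i j` the case `b = 1`. -/
theorem IsFace.exists_smul_eq {i j : P.latticePoints} (h : IsFace i j) {x y : ℤ × ℤ}
    (hx : x ∈ vertexMonoid i) (hy : y ∈ vertexMonoid i) {b : ℕ} (hxy : x + y = b • offset i j) :
    ∃ p q : ℕ, x = p • offset i j ∧ y = q • offset i j := by
  classical
  rw [vertexMonoid, ← Set.image_univ] at hx hy
  obtain ⟨n, -, rfl⟩ := exists_sum_offset_of_mem_closure hx
  obtain ⟨m, -, rfl⟩ := exists_sum_offset_of_mem_closure hy
  rw [← Finsupp.sum_add_index' (by simp) (by simp [add_smul])] at hxy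
  have h1 := genSum_add_single_eq (m := Finsupp.single j b) i (hxy.trans (by simp))
  rw [map_add P.genSum (Finsupp.single j b), genSum, Finsupp.linearCombination_single,
    Finsupp.linearCombination_single, add_comm (b • _)] at h1
  have h2 := h.2 _ _ _ h1
  have aux (n : P.latticePoints →₀ ℕ) (hn : ∀ u, n u ≠ 0 → u = i ∨ u = j) :
      (n.sum fun u k => k • offset i u) = n j • offset i j := by
    rw [Finsupp.sum, Finset.sum_eq_single j]
    · intro u hu huj
      rcases hn u (Finsupp.mem_support_iff.1 hu) with rfl | rfl
      · rw [offset_self, smul_zero]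
      · exact absurd rfl huj
    · intro hj
      rw [Finsupp.notMem_support_iff.1 hj, zero_smul]
  refine ⟨n j, m j, aux n fun u hu => h2 u ?_, aux m fun u hu => h2 u ?_⟩ <;>
  · simp only [Finsupp.add_apply]
    omega

theorem IsFace.offset_ne_zero {i j : P.latticePoints} (h : IsFace i j) : offset i j ≠ 0 := by
  rw [← offset_self i]
  exact fun h0 => h.1 (offset_injective i h0).symm

theorem IsFace.isSharp {i j : P.latticePoints} (h : IsFace i j) : IsSharp (vertexMonoid i) := by
  intro x hx y hy hxy
  obtain ⟨p, q, rfl, rfl⟩ := h.exists_smul_eq hx hy (b := 0) (by rw [hxy, zero_smul])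
  rw [← add_smul] at hxy
  have := (smul_eq_zero.1 hxy).resolve_right h.offset_ne_zero
  rw [show p = 0 by omega, zero_smul]

theorem IsFace.isIndecomposable {i j : P.latticePoints} (h : IsFace i j) :
    IsIndecomposable (vertexMonoid i) (offset i j) := by
  refine ⟨h.offset_ne_zero, fun x hx y hy hxy => ?_⟩
  obtain ⟨p, q, rfl, rfl⟩ := h.exists_smul_eq hx hy (b := 1) (by rw [hxy, one_smul])
  have h1 : ((p + q : ℕ) : ℤ) • offset i j = (1 : ℤ) • offset i j := by
    rw [natCast_zsmul, add_smul, hxy, one_smul]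
  have h2 := smul_left_injective ℤ h.offset_ne_zero h1
  have h3 : p = 0 ∨ q = 0 := by omega
  exact h3.imp (fun h => by rw [h, zero_smul]) (fun h => by rw [h, zero_smul])

end LatticePolygon

end FanoToric

namespace FanoToric

open MvPolynomial HomogeneousLocalization IsLocalRing

/-! ### Upper and lower bounds for the embedding dimension of a local ring. -/

section LocalRing

variable {R : Type*} [CommRing R]

/-- The maximal ideal is a minimal prime over `s`, so Krull's height theorem bounds the dimension,
which for a regular ring is the embedding dimension. -/
theorem spanFinrank_maximalIdeal_le_card [IsRegularLocalRing R] (s : Finset R)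
    (hs : ∀ x ∈ s, x ∈ maximalIdeal R)
    (h : ∀ p : Ideal R, p.IsPrime → (∀ x ∈ s, x ∈ p) → maximalIdeal R ≤ p) :
    (maximalIdeal R).spanFinrank ≤ s.card := by
  have hmin : maximalIdeal R ∈ (Ideal.span (s : Set R)).minimalPrimes :=
    ⟨⟨inferInstance, Ideal.span_le.2 hs⟩, fun p hp _ => h p hp.1 fun x hx =>
      hp.2 (Ideal.subset_span hx)⟩
  have h1 := Ideal.height_le_card_of_mem_minimalPrimes_span_finset hmin
  have h2 := IsRegularLocalRing.spanFinrank_maximalIdeal (R := R)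
  rw [← maximalIdeal_height_eq_ringKrullDim] at h2
  have h3 : ((maximalIdeal R).spanFinrank : ℕ∞) = (maximalIdeal R).height := by
    exact_mod_cast h2
  rw [← h3] at h1
  exact_mod_cast h1

/-- For `x` in the maximal ideal, the second component of `ψ (a * x)` is `(ψ a).fst` times that of
`ψ x`. The second components of minimal generators therefore span `ι → K`. -/
theorem card_le_spanFinrank_maximalIdeal [IsLocalRing R] [IsNoetherianRing R] {K ι : Type*}
    [Field K] [Fintype ι] [DecidableEq ι] (ψ : R →+* TrivSqZeroExt K (ι → K))
    (hψ : Function.Surjective fun x => (ψ x).fst)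
    (h : ∀ k, ∃ x ∈ maximalIdeal R, (ψ x).snd = Pi.single k 1) :
    Fintype.card ι ≤ (maximalIdeal R).spanFinrank := by
  classical
  let φ : R →+* K := (TrivSqZeroExt.fstHom K K (ι → K)).toRingHom.comp ψ
  have hφ : RingHom.ker φ = maximalIdeal R :=
    eq_maximalIdeal (RingHom.ker_isMaximal_of_surjective φ hψ)
  have hfst (x : R) (hx : x ∈ maximalIdeal R) : (ψ x).fst = 0 := by
    rw [← hφ] at hx
    exact hx
  have hfg := (maximalIdeal R).fg_of_isNoetherianRing
  have hfin := Submodule.FG.finite_generators hfg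
  let T : Submodule K (ι → K) :=
    Submodule.span K ((fun x => (ψ x).snd) '' (maximalIdeal R).generators)
  have hT (x : R) (hx : x ∈ maximalIdeal R) : (ψ x).snd ∈ T := by
    rw [← (maximalIdeal R).span_generators] at hx
    induction hx using Submodule.span_induction with
    | mem x hx => exact Submodule.subset_span ⟨x, hx, rfl⟩
    | zero => simp
    | add x y _ _ hx hy =>
      rw [map_add, TrivSqZeroExt.snd_add]
      exact add_mem hx hy
    | smul a x hx' hx =>
      have h0 : (ψ x).fst = 0 := by
        refine hfst x ?_
        rwa [← (maximalIdeal R).span_generators]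
      rw [smul_eq_mul, map_mul, TrivSqZeroExt.snd_mul, h0, MulOpposite.op_zero, zero_smul, add_zero]
      exact T.smul_mem _ hx
  have htop : T = ⊤ := by
    rw [eq_top_iff, ← (Pi.basisFun K ι).span_eq, Submodule.span_le]
    rintro _ ⟨k, rfl⟩
    obtain ⟨x, hx, hk⟩ := h k
    rw [Pi.basisFun_apply, ← hk]
    exact hT x hx
  have hcard := finrank_span_finset_le_card (R := K) ((hfin.image fun x => (ψ x).snd).toFinset)
  rw [Set.Finite.coe_toFinset] at hcard
  change Module.finrank K T ≤ _ at hcard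
  rw [htop, finrank_top, Module.finrank_fintype_fun_eq_card] at hcard
  refine hcard.trans ?_
  rw [← Set.ncard_eq_toFinset_card _ (hfin.image _), ← Submodule.FG.generators_ncard hfg]
  exact Set.ncard_image_le hfin

end LocalRing

/-! ### Regularity at a torus-fixed point bounds the number of generators at the vertex. -/

namespace LatticePolygon

variable {P : LatticePolygon} (K : Type*) [Field K]

/-- The grading of `K[S_P]`. -/
abbrev toricGrading (P : LatticePolygon) (K : Type*) [Field K] :
    ℕ → Submodule K (AddMonoidAlgebra K P.semigroup) := AddMonoidAlgebra.gradeBy K P.degree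

/-- The generator `x_u` of `K[S_P]`. -/
def gen (u : P.latticePoints) : AddMonoidAlgebra K P.semigroup :=
  AddMonoidAlgebra.single (P.generator u) 1

theorem gen_mem (u : P.latticePoints) : gen K u ∈ toricGrading P K 1 :=
  AddMonoidAlgebra.single_mem_gradeBy P.degree (P.generator u) (1 : K)

/-- The affine coordinate ring of the chart of `X_P` where the coordinate `i` is invertible. -/
abbrev ToricChart (i : P.latticePoints) : Type _ := Away (toricGrading P K) (gen K i)

/-- The affine coordinates on a chart of `X_P`. -/
def coord (i u : P.latticePoints) : ToricChart K i := fraction (gen_mem K i) (gen_mem K u)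

theorem coord_self (i : P.latticePoints) : coord K i i = 1 := fraction_self _

theorem aeval_coord_surjective (i : P.latticePoints) :
    Function.Surjective (aeval (coord K i) : MvPolynomial P.latticePoints K →ₐ[K] ToricChart K i) :=
  aeval_fraction_surjective (gen_mem K i) (gen_mem K) (aeval_generator_surjective P K)

/-- On this chart the coordinate of `i` is 1, so the padding by copies of `i` in
`genSum_add_single_eq` disappears. -/
theorem prod_coord_eq (i : P.latticePoints) {n m : P.latticePoints →₀ ℕ}
    (h : (n.sum fun u k => k • offset i u) = m.sum fun u k => k • offset i u) :
    (n.prod fun u k => coord K i u ^ k) = m.prod fun u k => coord K i u ^ k := by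
  classical
  have h1 := genSum_add_single_eq i h
  have key (n m : P.latticePoints →₀ ℕ) (h : P.genSum n = P.genSum m) :
      (n.prod fun u k => coord K i u ^ k) = m.prod fun u k => coord K i u ^ k := by
    have h0 : n.degree = m.degree := by rw [← degree_genSum, ← degree_genSum, h]
    have h2 : aeval (coord K i) (monomial n 1 - monomial m 1 : MvPolynomial P.latticePoints K) = 0 := by
      refine aeval_fraction_eq_zero (gen_mem K i) (gen_mem K) (n := n.degree)
        ((isHomogeneous_monomial _ rfl).sub (isHomogeneous_monomial _ h0.symm)) ?_
      have := aeval_monomial_generator P K n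
      rw [h, ← aeval_monomial_generator P K m] at this
      rw [map_sub, sub_eq_zero]
      exact this
    rw [map_sub, aeval_monomial, aeval_monomial, map_one, one_mul, one_mul] at h2
    exact sub_eq_zero.1 h2
  have h3 := key _ _ h1
  rw [Finsupp.prod_add_index' (by simp) (by simp [pow_add]),
    Finsupp.prod_add_index' (by simp) (by simp [pow_add]),
    Finsupp.prod_single_index (by simp), Finsupp.prod_single_index (by simp), coord_self, one_pow,
    one_pow, mul_one, mul_one] at h3
  exact h3

theorem position_sub_mem (i : P.latticePoints) (s : P.semigroup) :
    P.position s - P.degree s • (i : ℤ × ℤ) ∈ vertexMonoid i := by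
  obtain ⟨n, rfl⟩ := P.genSum_surjective s
  rw [degree_genSum, ← sum_offset]
  exact sum_mem fun u _ => nsmul_mem (offset_mem i u) _

open Classical in
/-- The character of the vertex monoid with values in the square-zero extension that records the
indecomposable elements. -/
def tangentValue (i : P.latticePoints) (E : Finset P.latticePoints) (z : ℤ × ℤ) :
    TrivSqZeroExt K (E → K) :=
  if z = 0 then 1 else TrivSqZeroExt.inr fun e => if z = offset i e then 1 else 0

variable {K}

/-- By sharpness, two nonzero elements have a nonzero sum. By indecomposability that sum is none of
the offsets of `E`, so both sides vanish. -/
theorem tangentValue_add {i : P.latticePoints} (hM : IsSharp (vertexMonoid i))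
    {E : Finset P.latticePoints}
    (hE : ∀ e ∈ E, IsIndecomposable (vertexMonoid i) (offset i e)) {x y : ℤ × ℤ}
    (hx : x ∈ vertexMonoid i) (hy : y ∈ vertexMonoid i) :
    tangentValue K i E (x + y) = tangentValue K i E x * tangentValue K i E y := by
  by_cases hx0 : x = 0
  · subst hx0
    simp [tangentValue]
  by_cases hy0 : y = 0
  · subst hy0
    simp [tangentValue]
  rw [tangentValue, tangentValue, tangentValue, if_neg hx0, if_neg hy0, TrivSqZeroExt.inr_mul_inr,
    if_neg fun h => hx0 (hM x hx y hy h)]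
  refine (congrArg TrivSqZeroExt.inr (_root_.funext fun e => ?_)).trans (TrivSqZeroExt.inr_zero K)
  refine if_neg fun h => ?_
  rcases (hE e e.2).2 x hx y hy h with h | h
  · exact hx0 h
  · exact hy0 h

/-- The homomorphism on the semigroup `S_P` that is given by the tangent vectors at a vertex. -/
def tangentCharacter {i : P.latticePoints} (hM : IsSharp (vertexMonoid i))
    {E : Finset P.latticePoints}
    (hE : ∀ e ∈ E, IsIndecomposable (vertexMonoid i) (offset i e)) :
    Multiplicative P.semigroup →* TrivSqZeroExt K (E → K) where
  toFun s := tangentValue K i E (P.position s.toAdd - P.degree s.toAdd • (i : ℤ × ℤ))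
  map_one' := by
    rw [toAdd_one, map_zero, map_zero, zero_smul, sub_zero, tangentValue, if_pos rfl]
  map_mul' s t := by
    rw [← tangentValue_add hM hE (position_sub_mem i _) (position_sub_mem i _), toAdd_mul,
      map_add, map_add, add_smul, add_sub_add_comm]

/-- The tangent vectors of `X_P` at a vertex. -/
theorem exists_tangentMap {i : P.latticePoints} (hM : IsSharp (vertexMonoid i))
    {E : Finset P.latticePoints}
    (hE : ∀ e ∈ E, IsIndecomposable (vertexMonoid i) (offset i e)) :
    ∃ ψ : ToricChart K i →ₐ[K] TrivSqZeroExt K (E → K),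
      ∀ u, ψ (coord K i u) = tangentValue K i E (offset i u) := by
  obtain ⟨Φ, hΦ'⟩ : ∃ Φ : AddMonoidAlgebra K P.semigroup →ₐ[K] TrivSqZeroExt K (E → K),
      ∀ s, Φ (AddMonoidAlgebra.single s 1) = tangentCharacter hM hE (Multiplicative.ofAdd s) :=
    ⟨AddMonoidAlgebra.lift K _ _ (tangentCharacter hM hE), fun s => by
      rw [AddMonoidAlgebra.lift_single, one_smul]⟩
  have hΦ (u : P.latticePoints) : Φ (gen K u) = tangentValue K i E (offset i u) := by
    rw [gen, hΦ', tangentCharacter, MonoidHom.coe_mk, OneHom.coe_mk, toAdd_ofAdd,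
      degree_generator, one_smul, position_generator, offset]
  have h1 : Φ (gen K i) = 1 := by
    rw [hΦ, offset_self, tangentValue, if_pos rfl]
  have h2 := fun u => (awayLift_fraction (gen_mem K i) Φ h1 (gen_mem K u)).trans (hΦ u)
  exact ⟨_, h2⟩

theorem fst_tangentValue (i : P.latticePoints) (E : Finset P.latticePoints) {z : ℤ × ℤ}
    (hz : z ≠ 0) : (tangentValue K i E z).fst = 0 := by
  rw [tangentValue, if_neg hz, TrivSqZeroExt.fst_inr]

/-- For `u ≠ i` the offset is a nonempty sum of offsets from `E`, so `coord K i u` is divisible by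
some `coord K i e` with `e ∈ E`. -/
theorem coord_mem_of_prime {i : P.latticePoints} {E : Finset P.latticePoints}
    (hgen : AddSubmonoid.closure (offset i '' (E : Set P.latticePoints)) = vertexMonoid i)
    (p : Ideal (ToricChart K i)) [p.IsPrime] (hp : ∀ e ∈ E, coord K i e ∈ p)
    {u : P.latticePoints} (hu : u ≠ i) : coord K i u ∈ p := by
  obtain ⟨n, hn, hsum⟩ := exists_sum_offset_of_mem_closure (hgen ▸ offset_mem i u)
  have h1 := prod_coord_eq K i (n := Finsupp.single u 1) (m := n) <| by
    rw [hsum]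
    exact (Finsupp.sum_single_index (h := fun u k => k • offset i u) (zero_nsmul _)).trans
      (one_nsmul _)
  rw [Finsupp.prod_single_index (by simp), pow_one] at h1
  rw [h1]
  have hne : n ≠ 0 := by
    rintro rfl
    rw [Finsupp.sum_zero_index, ← offset_self i] at hsum
    exact hu (offset_injective i hsum).symm
  obtain ⟨e, he⟩ := Finsupp.support_nonempty_iff.2 hne
  have he' := Finsupp.mem_support_iff.1 he
  exact p.mem_of_dvd (Finset.dvd_prod_of_mem _ he)
    (Ideal.pow_mem_of_mem _ (hp e (hn e he')) _ (Nat.pos_of_ne_zero he'))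

/-- A polygon with a regular torus-fixed point has at most two primitive directions at the
corresponding vertex. -/
theorem card_le_two (hX : IsNonsingular (P.toricSurface K)) {i : P.latticePoints}
    (hM : IsSharp (vertexMonoid i)) {E : Finset P.latticePoints}
    (hgen : AddSubmonoid.closure (offset i '' (E : Set P.latticePoints)) = vertexMonoid i)
    (hE : ∀ e ∈ E, IsIndecomposable (vertexMonoid i) (offset i e)) : E.card ≤ 2 := by
  classical
  obtain ⟨ψ, hψ⟩ := exists_tangentMap (K := K) hM hE
  let φ : ToricChart K i →ₐ[K] K := (TrivSqZeroExt.fstHom K K (E → K)).comp ψ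
  let q : Ideal (ToricChart K i) := RingHom.ker φ
  have hq : q.IsPrime := RingHom.ker_isPrime φ
  have hcoord {u : P.latticePoints} (hu : offset i u ≠ 0) : coord K i u ∈ q := by
    change (ψ (coord K i u)).fst = 0
    rw [hψ, fst_tangentValue i E hu]
  have hreg : IsRegularLocalRing (Localization.AtPrime q) := by
    obtain ⟨e⟩ := nonempty_stalk_ringEquiv (toricGrading P K) (gen_mem K i) Nat.one_pos ⟨q, hq⟩
    have : IsRegularLocalRing ((AlgebraicGeometry.Proj (toricGrading P K)).presheaf.stalk
      (pointOfPrime (toricGrading P K) (gen_mem K i) Nat.one_pos ⟨q, hq⟩)) :=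
      hX (pointOfPrime (toricGrading P K) (gen_mem K i) Nat.one_pos ⟨q, hq⟩)
    exact IsRegularLocalRing.of_ringEquiv e
  have hunit (y : q.primeCompl) : IsUnit (ψ y) := by
    rw [TrivSqZeroExt.isUnit_iff_isUnit_fst, isUnit_iff_ne_zero]
    exact y.2
  let Ψ : Localization.AtPrime q →+* TrivSqZeroExt K (E → K) :=
    IsLocalization.lift (M := q.primeCompl) (g := (ψ : ToricChart K i →+* _)) hunit
  have hΨ (x : ToricChart K i) : Ψ (algebraMap _ _ x) = ψ x := IsLocalization.lift_eq _ _
  have hmem {x : ToricChart K i} (hx : x ∈ q) :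
      algebraMap _ (Localization.AtPrime q) x ∈ maximalIdeal (Localization.AtPrime q) := by
    rw [← Localization.AtPrime.map_eq_maximalIdeal]
    exact Ideal.mem_map_of_mem _ hx
  have hlow := card_le_spanFinrank_maximalIdeal Ψ
    (fun c => ⟨algebraMap _ _ (algebraMap K _ c), by
      change (Ψ _).fst = c
      rw [hΨ, AlgHom.commutes]
      rfl⟩)
    (fun e => ⟨algebraMap _ _ (coord K i e), hmem (hcoord (hE e e.2).1), by
      rw [hΨ, hψ, tangentValue, if_neg (hE e e.2).1, TrivSqZeroExt.snd_inr]
      ext f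
      rw [Pi.single_apply]
      exact if_congr ⟨fun h => Subtype.ext (offset_injective i h).symm, fun h => h ▸ rfl⟩ rfl rfl⟩)
  rw [Fintype.card_coe] at hlow
  by_contra hcard
  obtain ⟨v, hv⟩ : ∃ v : Fin 3 → P.latticePoints, Function.Injective v ∧ ∀ l, v l ∈ E := by
    obtain ⟨F, hF, hF3⟩ := Finset.exists_subset_card_eq (show 3 ≤ E.card by omega)
    exact ⟨fun l => (F.equivFin.symm (Fin.cast hF3.symm l) : P.latticePoints),
      fun a b h => by simpa using Subtype.ext h, fun l => hF (F.equivFin.symm _).2⟩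
  obtain ⟨hinj, hvE⟩ := hv
  have hpos (a : Fin 3 → ℕ) (ha : ∑ l, a l • offset i (v l) = 0) : a = 0 := by
    ext l
    rw [← Finset.add_sum_erase _ _ (Finset.mem_univ l)] at ha
    have h := hM _ (nsmul_mem (offset_mem i _) _) _
      (sum_mem fun l _ => nsmul_mem (offset_mem i _) _) ha
    exact (smul_eq_zero.1 h).resolve_right (hE _ (hvE l)).1
  obtain ⟨k, c, a, hc, hak, hrel⟩ := exists_nsmul_eq_of_three (fun l => offset i (v l)) hpos
  have ha : ∃ l, a l ≠ 0 := by
    by_contra! h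
    have h1 : c • offset i (v k) = 0 := by simpa [h] using hrel
    exact (smul_eq_zero.1 h1).elim hc (hE _ (hvE k)).1
  obtain ⟨l, hl⟩ := ha
  -- Since `a k = 0` and some `a l ≠ 0`, a prime that contains the other coordinates also contains
  -- `coord K i (v k)`, which can therefore be dropped from the system of parameters.
  have hrel' : coord K i (v k) ^ c = ∏ l, coord K i (v l) ^ a l := by
    have h := prod_coord_eq K i (n := Finsupp.single (v k) c)
      (m := ∑ l, Finsupp.single (v l) (a l)) <| by
        rw [← Finsupp.sum_finsetSum_index (by simp) (by simp [add_smul])]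
        simpa using hrel
    rw [← Finsupp.prod_finsetSum_index (by simp) (by simp [pow_add])] at h
    simpa using h
  -- the remaining coordinates define the fixed point set-theoretically
  have hup := spanFinrank_maximalIdeal_le_card
    ((E.erase (v k)).image fun e => algebraMap _ (Localization.AtPrime q) (coord K i e))
    (by
      simp only [Finset.mem_image]
      rintro _ ⟨e, he, rfl⟩
      exact hmem (hcoord (hE e (Finset.mem_of_mem_erase he)).1))
    (by
      intro p hp hpE
      let p' : Ideal (ToricChart K i) := p.comap (algebraMap _ _)
      have hp' : p'.IsPrime := Ideal.comap_isPrime _ _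
      have hp'E (e : P.latticePoints) (he : e ∈ E) : coord K i e ∈ p' := by
        have h (e : P.latticePoints) (he : e ∈ E.erase (v k)) : coord K i e ∈ p' :=
          hpE _ (Finset.mem_image_of_mem _ he)
        by_cases hek : e = v k
        · rw [hek]
          refine hp'.mem_of_pow_mem c ?_
          rw [hrel']
          refine p'.mem_of_dvd (Finset.dvd_prod_of_mem _ (Finset.mem_univ l))
            (Ideal.pow_mem_of_mem _ (h _ ?_) _ (Nat.pos_of_ne_zero hl))
          refine Finset.mem_erase.2 ⟨fun hlk => hl ?_, hvE l⟩
          rw [hinj hlk, hak]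
        · exact h e (Finset.mem_erase.2 ⟨hek, he⟩)
      have hle : p' ≤ q := by
        have h := (Ideal.comap_mono (f := algebraMap (ToricChart K i) (Localization.AtPrime q))
          (le_maximalIdeal hp.ne_top))
        exact h.trans_eq (IsLocalization.AtPrime.under_maximalIdeal (Localization.AtPrime q) q)
      rw [← Localization.AtPrime.map_eq_maximalIdeal, Ideal.map_le_iff_le_comap]
      intro r hr
      obtain ⟨F, rfl⟩ := aeval_coord_surjective K i r
      -- Modulo `p'` every coordinate is 0 or 1, so each element of the chart is congruent to a
      -- constant. For an element of `q` this constant lies in `q`, since `p' ≤ q`, and hence is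
      -- zero.
      have hmk : (Ideal.Quotient.mkₐ K p').comp (aeval (coord K i)) =
          (Algebra.ofId K (ToricChart K i ⧸ p')).comp
            (aeval (Pi.single i (1 : K) : P.latticePoints → K)) := by
        ext u
        rw [AlgHom.comp_apply, AlgHom.comp_apply, aeval_X, aeval_X]
        by_cases hu : u = i
        · subst hu
          rw [coord_self, map_one, Pi.single_eq_same, map_one]
        · rw [Pi.single_eq_of_ne hu, map_zero]
          exact Ideal.Quotient.eq_zero_iff_mem.2 (coord_mem_of_prime hgen p' hp'E hu)
      have h1 : aeval (coord K i) F - algebraMap K _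
          (aeval (Pi.single i (1 : K) : P.latticePoints → K) F) ∈ p' := by
        rw [← Ideal.Quotient.eq_zero_iff_mem, map_sub, sub_eq_zero]
        exact DFunLike.congr_fun hmk F
      have h2 : algebraMap K _ (aeval (Pi.single i (1 : K) : P.latticePoints → K) F) ∈ q := by
        have := sub_mem hr (hle h1)
        rwa [sub_sub_cancel] at this
      have h3 : φ (algebraMap K _ (aeval (Pi.single i (1 : K) : P.latticePoints → K) F)) = 0 := h2
      rw [AlgHom.commutes] at h3
      rw [show aeval (Pi.single i (1 : K) : P.latticePoints → K) F = 0 from h3, map_zero,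
        sub_zero] at h1
      exact h1)
  have h1 := hlow.trans (hup.trans Finset.card_image_le)
  exact absurd (Finset.card_erase_lt_of_mem (hvE k)) (not_lt.2 h1)

end LatticePolygon

end FanoToric

namespace FanoToric

open MvPolynomial HomogeneousLocalization

/-! ### Coordinates along an edge with smooth endpoints. -/

namespace LatticePolygon

variable {P : LatticePolygon} {K : Type*} [Field K]

/-- The lattice points of a polygon do not lie on a line. -/
theorem exists_det_ne_zero (i : P.latticePoints) {d : ℤ × ℤ} (hd : d ≠ 0) :
    ∃ u : P.latticePoints, d.1 * (offset i u).2 - d.2 * (offset i u).1 ≠ 0 := by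
  by_contra! h
  let L : ℝ × ℝ →ₗ[ℝ] ℝ := (d.1 : ℝ) • LinearMap.snd ℝ ℝ ℝ - (d.2 : ℝ) • LinearMap.fst ℝ ℝ ℝ
  have hL (x : ℝ × ℝ) : L x = d.1 * x.2 - d.2 * x.1 := by simp [L]
  let H : Set (ℝ × ℝ) := L ⁻¹' {L (latticeInclusion i)}
  have hH : convexHull ℝ (latticeInclusion '' (P.points : Set (ℤ × ℤ))) ⊆ H := by
    refine convexHull_min ?_ ((convex_singleton _).linear_preimage L)
    rintro _ ⟨u, hu, rfl⟩
    have hu' : u ∈ P.latticePoints := subset_convexHull ℝ _ ⟨u, hu, rfl⟩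
    have h1 := h ⟨u, hu'⟩
    rw [offset] at h1
    have h2 : (d.1 : ℝ) * (u.2 - (i : ℤ × ℤ).2) - d.2 * (u.1 - (i : ℤ × ℤ).1) = 0 := by
      exact_mod_cast h1
    change L _ = L _
    rw [hL, hL]
    simp only [latticeInclusion]
    linear_combination h2
  obtain ⟨x, hx⟩ := P.interior_nonempty
  obtain ⟨ε, hε, hball⟩ := Metric.mem_nhds_iff.1 (mem_interior_iff_mem_nhds.1 (interior_mono hH hx))
  -- This is the normal of the line, with `L v = d.1 ^ 2 + d.2 ^ 2`. A small step along it from an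
  -- interior point would stay in `H`, on which `L` is constant.
  let v : ℝ × ℝ := (-(d.2 : ℝ), (d.1 : ℝ))
  have hv : 0 < ‖v‖ + 1 := by positivity
  have hmem : x + (ε / 2 / (‖v‖ + 1)) • v ∈ H := by
    refine hball ?_
    rw [Metric.mem_ball, dist_eq_norm, add_sub_cancel_left, norm_smul, Real.norm_of_nonneg
      (by positivity), div_mul_eq_mul_div, div_lt_iff₀ hv]
    nlinarith [norm_nonneg v]
  have hx' : x ∈ H := hball (Metric.mem_ball_self hε)
  have h1 : L (x + (ε / 2 / (‖v‖ + 1)) • v) = L x := Eq.trans hmem (Eq.symm hx')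
  rw [map_add, add_eq_left, map_smul, smul_eq_zero] at h1
  rcases h1 with h1 | h1
  · exact absurd h1 (by positivity)
  · rw [hL] at h1
    simp only [v] at h1
    have h2 : (d.1 : ℝ) ^ 2 + (d.2 : ℝ) ^ 2 = 0 := by linear_combination h1
    have h3 : d.1 ^ 2 + d.2 ^ 2 = 0 := by exact_mod_cast h2
    refine hd (Prod.ext ?_ ?_)
    · change d.1 = 0
      nlinarith [sq_nonneg d.1, sq_nonneg d.2]
    · change d.2 = 0
      nlinarith [sq_nonneg d.1, sq_nonneg d.2]

/-- At an endpoint of a face, two lattice points generate the vertex monoid. -/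
theorem IsFace.exists_generators (hX : IsNonsingular (P.toricSurface K)) {i j : P.latticePoints}
    (h : IsFace i j) : ∃ k : P.latticePoints, ∀ u, ∃ a b : ℕ,
      offset i u = a • offset i j + b • offset i k := by
  classical
  obtain ⟨E, hgen, hE⟩ := exists_finset_isIndecomposable (offset i) h.isSharp
  have hcard := card_le_two hX h.isSharp hgen hE
  have hj : j ∈ E := by
    have h1 := IsIndecomposable.mem_of_mem_closure (S := offset i '' E) (e := offset i j)
      (by rw [hgen]; exact h.isIndecomposable) (by rw [hgen]; exact offset_mem i j)
    obtain ⟨e, he, h2⟩ := h1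
    exact offset_injective i h2 ▸ he
  have : Nonempty P.latticePoints := ⟨i⟩
  obtain ⟨k, hk⟩ := Finset.card_le_one_iff_subset_singleton.1 (show (E.erase j).card ≤ 1 by
    rw [Finset.card_erase_of_mem hj]
    omega)
  refine ⟨k, fun u => ?_⟩
  have hle : vertexMonoid i ≤ AddSubmonoid.closure {offset i j, offset i k} := by
    rw [vertexMonoid, ← hgen]
    refine AddSubmonoid.closure_mono ?_
    rintro _ ⟨e, he, rfl⟩
    by_cases hej : e = j
    · exact Or.inl (by rw [hej])
    · exact Or.inr (by rw [Finset.mem_singleton.1 (hk (Finset.mem_erase.2 ⟨hej, he⟩))]; rfl)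
  obtain ⟨a, b, hab⟩ := (AddSubmonoid.mem_closure_pair _ _ _).1 (hle (offset_mem i u))
  exact ⟨a, b, hab.symm⟩

/-- If `q` were nonzero, `offset i k` would be parallel to `offset i j`. All lattice points would
then lie on one line, against `exists_det_ne_zero`. -/
theorem eq_zero_of_smul_add_smul_eq_zero {i j k : P.latticePoints} (hij : i ≠ j)
    (h : ∀ u, ∃ a b : ℕ, offset i u = a • offset i j + b • offset i k) {p q : ℤ}
    (hpq : p • offset i j + q • offset i k = 0) : p = 0 ∧ q = 0 := by
  have hj : offset i j ≠ 0 := by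
    rw [← offset_self i]
    exact fun h0 => hij (offset_injective i h0).symm
  obtain ⟨u, hu⟩ := exists_det_ne_zero i hj
  obtain ⟨a, b, hab⟩ := h u
  rw [hab, ← natCast_zsmul, ← natCast_zsmul] at hu
  have h1 := congrArg Prod.fst hpq
  have h2 := congrArg Prod.snd hpq
  simp only [Prod.fst_add, Prod.snd_add, Prod.smul_fst, Prod.smul_snd, smul_eq_mul,
    Prod.fst_zero, Prod.snd_zero] at h1 h2 hu
  have hq : q = 0 := by
    by_contra hq
    refine hu ?_
    have h3 : q * ((offset i j).1 * (offset i k).2 - (offset i j).2 * (offset i k).1) = 0 := by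
      linear_combination (offset i j).1 * h2 - (offset i j).2 * h1
    have h4 := (mul_eq_zero.1 h3).resolve_left hq
    linear_combination (b : ℤ) * h4
  subst hq
  rw [zero_smul, add_zero] at hpq
  exact ⟨(smul_eq_zero.1 hpq).resolve_right hj, rfl⟩

/-- Coordinates on a polygon which is smooth at the endpoints `i` and `j` of a face: every lattice
point `u` is `i + a u • (j - i) + b u • (k - i)`, and it has the form
`j + c u • (i - j) + b u • (l - j)`. -/
structure FaceCoordinates (i j : P.latticePoints) where
  /-- The neighbor of `i`. -/
  k : P.latticePoints
  /-- The neighbor of `j`. -/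
  l : P.latticePoints
  /-- The difference of `1` and the self-intersection number. -/
  m : ℕ
  /-- The coordinate along the face, from `i`. -/
  a : P.latticePoints → ℕ
  /-- The distance from the face. -/
  b : P.latticePoints → ℕ
  /-- The coordinate along the face, from `j`. -/
  c : P.latticePoints → ℕ
  offset_eq (u : P.latticePoints) : offset i u = a u • offset i j + b u • offset i k
  offset_l : offset i l = m • offset i j + offset i k
  sum_eq (u : P.latticePoints) : c u + a u + b u = 1 + m * b u
  indep {p q : ℤ} (h : p • offset i j + q • offset i k = 0) : p = 0 ∧ q = 0

theorem IsFace.nonempty_faceCoordinates (hX : IsNonsingular (P.toricSurface K))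
    {i j : P.latticePoints} (h : IsFace i j) : Nonempty (FaceCoordinates i j) := by
  obtain ⟨k, hk⟩ := h.exists_generators hX
  obtain ⟨l, hl⟩ := h.symm.exists_generators hX
  have hind {p q : ℤ} (hpq : p • offset i j + q • offset i k = 0) : p = 0 ∧ q = 0 :=
    eq_zero_of_smul_add_smul_eq_zero h.1 hk hpq
  choose a b hab using hk
  choose c b' hcb using hl
  have hshift (u : P.latticePoints) : offset j u = offset i u - offset i j := by
    simp only [offset]
    abel
  -- The expansion of `offset j u` at `j`, rewritten in the basis at `i`, is compared with the
  -- expansion of `offset i u`.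
  have key (u : P.latticePoints) : ((a u : ℤ) - 1 + c u - b' u * ((a l : ℤ) - 1)) • offset i j +
      ((b u : ℤ) - b' u * b l) • offset i k = 0 := by
    have h1 := hcb u
    rw [hshift u, hshift i, hshift l, hab u, hab l, offset_self] at h1
    simp only [← natCast_zsmul] at h1
    linear_combination (exp := 1) h1
  have hk1 : a k = 0 ∧ b k = 1 := by
    have h1 : ((a k : ℤ)) • offset i j + ((b k : ℤ) - 1) • offset i k = 0 := by
      have h1 := hab k
      simp only [← natCast_zsmul] at h1
      linear_combination (exp := 1) - h1
    have := hind h1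
    omega
  have hk2 := hind (key k)
  rw [hk1.1, hk1.2] at hk2
  -- The case `u = k` gives `b' k * b l = 1` in natural numbers. Thus `l` is at distance 1 from the
  -- face, and both endpoints measure the same distance `b`.
  have hbl : b' k = 1 ∧ b l = 1 := by
    have : b' k * b l = 1 := by
      have := hk2.2
      push_cast at this
      zify
      linarith
    exact ⟨Nat.eq_one_of_mul_eq_one_right this, Nat.eq_one_of_mul_eq_one_left this⟩
  refine ⟨⟨k, l, a l, a, b, c, hab, ?_, fun u => ?_, hind⟩⟩
  · rw [hab l, hbl.2, one_smul]
  · obtain ⟨h1, h2⟩ := hind (key u)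
    rw [hbl.2] at h2
    have h3 : b' u = b u := by
      push_cast at h2
      omega
    rw [h3] at h1
    zify
    linear_combination h1

/-- A family of elements which satisfies the multiplicative relations of the generators of `S_P`
satisfies the equations of `X_P`. -/
theorem aeval_eq_zero_of_mem_toricIdeal {T : Type*} [CommRing T] [Algebra K T]
    {ℓ : P.latticePoints → T}
    (h : ∀ n m : P.latticePoints →₀ ℕ, P.genSum n = P.genSum m →
      (n.prod fun u k => ℓ u ^ k) = m.prod fun u k => ℓ u ^ k)
    {f : MvPolynomial P.latticePoints K} (hf : f ∈ P.toricIdeal K) : aeval ℓ f = 0 := by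
  classical
  -- By `h`, the product does not depend on the chosen representation, so it is a character of
  -- `S_P`, and evaluation at `ℓ` factors through `K[S_P]`.
  let r : P.semigroup → (P.latticePoints →₀ ℕ) := Function.surjInv P.genSum_surjective
  have hr (s : P.semigroup) : P.genSum (r s) = s := Function.surjInv_eq P.genSum_surjective s
  let φ : Multiplicative P.semigroup →* T :=
    { toFun := fun s => (r s.toAdd).prod fun u k => ℓ u ^ k
      map_one' := by
        rw [h _ 0 (by rw [hr, map_zero, toAdd_one])]
        exact Finsupp.prod_zero_index
      map_mul' := fun s t => by
        rw [h _ (r s.toAdd + r t.toAdd) (by rw [map_add, hr, hr, hr, toAdd_mul])]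
        exact Finsupp.prod_add_index' (by simp) (by simp [pow_add]) }
  have hφ (u : P.latticePoints) : φ (Multiplicative.ofAdd (P.generator u)) = ℓ u := by
    refine (h _ (Finsupp.single u 1) ?_).trans ?_
    · rw [hr, genSum, Finsupp.linearCombination_single, one_smul, toAdd_ofAdd]
    · rw [Finsupp.prod_single_index (by simp), pow_one]
  have hcomp : (aeval ℓ : MvPolynomial P.latticePoints K →ₐ[K] T) =
      (AddMonoidAlgebra.lift K T P.semigroup φ).comp
        (aeval fun u => AddMonoidAlgebra.single (P.generator u) (1 : K)) := by
    ext u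
    rw [AlgHom.comp_apply, aeval_X, aeval_X, AddMonoidAlgebra.lift_single, one_smul, hφ]
  rw [hcomp, AlgHom.comp_apply]
  exact (congrArg _ (RingHom.mem_ker.1 hf)).trans (map_zero _)

/-! ### The universal line in the chart of a face. -/

namespace FaceCoordinates

variable {i j : P.latticePoints} (D : FaceCoordinates i j)

theorem eq_and_eq {u : P.latticePoints} {p q : ℤ}
    (h : offset i u = p • offset i j + q • offset i D.k) :
    D.a u = p ∧ D.b u = q := by
  have h1 := D.offset_eq u
  simp only [← natCast_zsmul] at h1
  have := D.indep (p := D.a u - p) (q := D.b u - q) (by linear_combination (exp := 1) h - h1)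
  omega

theorem coord_i : D.a i = 0 ∧ D.b i = 0 ∧ D.c i = 1 := by
  have h := D.eq_and_eq (u := i) (p := 0) (q := 0) (by simp [offset_self])
  have h2 := D.sum_eq i
  have hb : D.b i = 0 := by omega
  rw [hb] at h2
  omega

theorem coord_j : D.a j = 1 ∧ D.b j = 0 ∧ D.c j = 0 := by
  have h := D.eq_and_eq (u := j) (p := 1) (q := 0) (by simp)
  have h2 := D.sum_eq j
  have hb : D.b j = 0 := by omega
  rw [hb] at h2
  omega

theorem coord_k : D.a D.k = 0 ∧ D.b D.k = 1 ∧ D.c D.k = D.m := by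
  have h := D.eq_and_eq (u := D.k) (p := 0) (q := 1) (by simp)
  have h2 := D.sum_eq D.k
  have hb : D.b D.k = 1 := by omega
  rw [hb] at h2
  omega

/-- The product `s ^ c u * t ^ a u * γ ^ b u`. -/
def monomialAt {T : Type*} [CommRing T] (s t γ : T) (u : P.latticePoints) : T :=
  s ^ D.c u * t ^ D.a u * γ ^ D.b u

/-- The exponents of `s`, `t` and `γ` are additive functions on `S_P`: those of `t` and `γ` are
determined by the position, and that of `s` also involves the degree, through `sum_eq`. -/
theorem aeval_monomialAt {T : Type*} [CommRing T] [Algebra K T] (s t γ : T)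
    {f : MvPolynomial P.latticePoints K} (hf : f ∈ P.toricIdeal K) :
    aeval (D.monomialAt s t γ) f = 0 := by
  refine aeval_eq_zero_of_mem_toricIdeal (fun n m h => ?_) hf
  let S (w : P.latticePoints → ℕ) (n : P.latticePoints →₀ ℕ) : ℕ := ∑ u ∈ n.support, w u * n u
  have hprod (n : P.latticePoints →₀ ℕ) : (n.prod fun u k => D.monomialAt s t γ u ^ k) =
      s ^ S D.c n * t ^ S D.a n * γ ^ S D.b n := by
    simp only [Finsupp.prod, monomialAt, mul_pow, Finset.prod_mul_distrib, ← pow_mul,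
      Finset.prod_pow_eq_pow_sum, S]
  have hoff (n : P.latticePoints →₀ ℕ) : (n.sum fun u k => k • offset i u) =
      (S D.a n : ℤ) • offset i j + (S D.b n : ℤ) • offset i D.k := by
    simp only [Finsupp.sum, S, Nat.cast_sum, Finset.sum_smul, ← Finset.sum_add_distrib]
    refine Finset.sum_congr rfl fun u _ => ?_
    rw [D.offset_eq u, natCast_zsmul, natCast_zsmul, smul_add, smul_smul, smul_smul,
      mul_comm (n u), mul_comm (n u)]
  have hsum (n : P.latticePoints →₀ ℕ) :
      S D.c n + S D.a n + S D.b n = n.degree + D.m * S D.b n := by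
    simp only [S, Finsupp.degree_apply, Finset.mul_sum, ← Finset.sum_add_distrib]
    refine Finset.sum_congr rfl fun u _ => ?_
    linear_combination n u * D.sum_eq u
  have hdeg : n.degree = m.degree := by rw [← degree_genSum, ← degree_genSum, h]
  have h1 : (n.sum fun u k => k • offset i u) = m.sum fun u k => k • offset i u := by
    rw [sum_offset, sum_offset, h, hdeg]
  rw [hoff, hoff] at h1
  have h2 := D.indep (p := S D.a n - S D.a m) (q := S D.b n - S D.b m)
    (by linear_combination (exp := 1) h1)
  have ha : S D.a n = S D.a m := by omega
  have hb : S D.b n = S D.b m := by omega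
  have hc : S D.c n = S D.c m := by
    have h3 := hsum n
    have h4 := hsum m
    rw [ha, hb, hdeg] at h3
    omega
  rw [hprod, hprod, ha, hb, hc]

variable {T : Type*} [CommRing T] [Algebra K T] {ℓ : P.latticePoints → T}

theorem mul_pow_eq (hℓ : ∀ f ∈ P.toricIdeal K, aeval ℓ f = 0) (u : P.latticePoints) :
    ℓ u * ℓ i ^ (D.a u + D.b u) = ℓ i * ℓ j ^ D.a u * ℓ D.k ^ D.b u := by
  classical
  have h1 := genSum_add_single_eq i (n := Finsupp.single u 1)
    (m := Finsupp.single j (D.a u) + Finsupp.single D.k (D.b u)) <| by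
      rw [Finsupp.sum_add_index' (by simp) (by simp [add_smul])]
      simpa using! D.offset_eq u
  have h2 := prod_eq_of_genSum_eq hℓ h1
  rw [map_add, Finsupp.degree_single, Finsupp.degree_single, Finsupp.degree_single] at h2
  simp only [Finsupp.prod_add_index' (h := fun u k => ℓ u ^ k) (fun _ => pow_zero _)
    (fun _ _ _ => pow_add _ _ _), Finsupp.prod_single_index (h := fun u k => ℓ u ^ k) (pow_zero _)]
    at h2
  linear_combination h2

theorem mul_pow_l_eq (hℓ : ∀ f ∈ P.toricIdeal K, aeval ℓ f = 0) :
    ℓ D.l * ℓ i ^ (D.m + 1) = ℓ j ^ D.m * ℓ D.k * ℓ i := by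
  classical
  have h1 := genSum_add_single_eq i (n := Finsupp.single D.l 1)
    (m := Finsupp.single j D.m + Finsupp.single D.k 1) <| by
      rw [Finsupp.sum_add_index' (by simp) (by simp [add_smul])]
      simpa using! D.offset_l
  have h2 := prod_eq_of_genSum_eq hℓ h1
  rw [map_add, Finsupp.degree_single, Finsupp.degree_single, Finsupp.degree_single] at h2
  simp only [Finsupp.prod_add_index' (h := fun u k => ℓ u ^ k) (fun _ => pow_zero _)
    (fun _ _ _ => pow_add _ _ _), Finsupp.prod_single_index (h := fun u k => ℓ u ^ k) (pow_zero _)]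
    at h2
  simpa only [pow_one] using h2

/-- The three values of `γ` are treated together here. The hypothesis `hγ` makes the monomials a
family of linear forms, `hw` recovers the parameters from Plücker coordinates, and `huniv` is the
one constraint on `ℓ_k` that depends on `m`. Once `ℓ_k` is known, every other `ℓ_u` is determined by
`mul_pow_eq`. -/
theorem exists_chart_ringEquiv {τ : Type*} {γ : MvPolynomial (Fin 2) (MvPolynomial τ K)}
    (hγ : ∀ u, (D.monomialAt (X 0) (X 1) γ u).IsHomogeneous 1)
    (w : τ → P.latticePoints × P.latticePoints)
    (hw : ∀ x y : P.latticePoints → MvPolynomial τ K, x i = 1 → x j = 0 → y i = 0 → y j = 1 →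
      linearForm (x D.k) (y D.k) = X 0 ^ D.m * γ →
      ∀ t, x (w t).1 * y (w t).2 - x (w t).2 * y (w t).1 = X t)
    (huniv : ∀ x₁ y₁ x₂ y₂ : FanoChart (P.toricIdeal K) (i, j),
      linearForm x₂ y₂ * X 0 ^ (D.m + 1) = X 1 ^ D.m * linearForm x₁ y₁ * X 0 →
      ∃ θ : MvPolynomial τ K →ₐ[K] FanoChart (P.toricIdeal K) (i, j),
        linearForm x₁ y₁ = X 0 ^ D.m * MvPolynomial.map (θ : MvPolynomial τ K →+* _) γ) :
    Nonempty (FanoChart (P.toricIdeal K) (i, j) ≃+* MvPolynomial τ K) := by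
  choose x y hxy using fun u => exists_eq_linearForm (hγ u)
  obtain ⟨hai, hbi, hci⟩ := D.coord_i
  obtain ⟨haj, hbj, hcj⟩ := D.coord_j
  obtain ⟨hak, hbk, hck⟩ := D.coord_k
  have hi : linearForm (x i) (y i) = linearForm 1 0 := by
    rw [← hxy, monomialAt, hai, hbi, hci]
    simp [linearForm]
  have hj : linearForm (x j) (y j) = linearForm 0 1 := by
    rw [← hxy, monomialAt, haj, hbj, hcj]
    simp [linearForm]
  have hk : linearForm (x D.k) (y D.k) = X 0 ^ D.m * γ := by
    rw [← hxy, monomialAt, hak, hbk, hck]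
    simp
  obtain ⟨hxi, hyi⟩ := linearForm_inj hi
  obtain ⟨hxj, hyj⟩ := linearForm_inj hj
  refine nonempty_fanoChart_ringEquiv _ hxi hxj hyi hyj (fun f hf => ?_) w
    (hw x y hxi hxj hyi hyj hk) fun x' y' hxi' hxj' hyi' hyj' hI' => ?_
  · rw [← D.aeval_monomialAt (X 0) (X 1) γ hf]
    congr 2
    ext1 u
    exact (hxy u).symm
  · have hℓi : linearForm (x' i) (y' i) = X 0 := by simp [linearForm, hxi', hyi']
    have hℓj : linearForm (x' j) (y' j) = X 1 := by simp [linearForm, hxj', hyj']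
    have hl := D.mul_pow_l_eq hI'
    simp only [hℓi, hℓj] at hl
    obtain ⟨θ, hθ⟩ := huniv _ _ _ _ hl
    refine ⟨θ, fun u => ?_⟩
    have hu := D.mul_pow_eq hI' u
    simp only [hℓi, hℓj, hθ] at hu
    have hmap : linearForm (x' u) (y' u) =
        MvPolynomial.map (θ : MvPolynomial τ K →+* FanoChart (P.toricIdeal K) (i, j))
          (D.monomialAt (X 0) (X 1) γ u) := by
      -- The chart ring is not yet known to be a domain, but the variable `s` is a non-zero-divisor
      -- over any ring, so its powers cancel.
      have hreg : (X 0 ^ (D.a u + D.b u) : MvPolynomial (Fin 2) (FanoChart (P.toricIdeal K) (i, j))) ∈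
          nonZeroDivisors _ := pow_mem (isRegular_X.mem_nonZeroDivisors) _
      refine (mul_cancel_right_mem_nonZeroDivisors hreg).1 ?_
      rw [hu, monomialAt, map_mul, map_mul, map_pow, map_pow, map_pow, MvPolynomial.map_X,
        MvPolynomial.map_X, mul_pow,
        ← pow_mul]
      have h1 : (X 0 : MvPolynomial (Fin 2) (FanoChart (P.toricIdeal K) (i, j))) *
          X 0 ^ (D.m * D.b u) = X 0 ^ D.c u * X 0 ^ (D.a u + D.b u) := by
        rw [← pow_succ', ← pow_add]
        congr 1
        have := D.sum_eq u
        omega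
      linear_combination (X 1 ^ D.a u * (MvPolynomial.map (θ : MvPolynomial τ K →+* _) γ) ^ D.b u) * h1
    rw [hxy u, map_linearForm] at hmap
    exact linearForm_inj hmap

/-- Here `γ = ℓ_k` is unconstrained. Its two coefficients are the Plücker coordinates `(k, j)` and
`(i, k)`. -/
theorem nonempty_chart_ringEquiv_of_eq_zero (hm : D.m = 0) :
    Nonempty (FanoChart (P.toricIdeal K) (i, j) ≃+* MvPolynomial (Fin 2) K) := by
  refine D.exists_chart_ringEquiv (γ := linearForm (X 0) (X 1)) (fun u => ?_)
    ![(D.k, j), (i, D.k)] (fun x y hxi hxj hyi hyj hk t => ?_)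
    fun x₁ y₁ x₂ y₂ h => ⟨aeval ![x₁, y₁], ?_⟩
  · have h1 := D.sum_eq u
    rw [hm, zero_mul, add_zero] at h1
    have h2 : (linearForm (X 0) (X 1) :
        MvPolynomial (Fin 2) (MvPolynomial (Fin 2) K)).IsHomogeneous 1 :=
      ((isHomogeneous_X _ (0 : Fin 2)).C_mul _).add ((isHomogeneous_X _ (1 : Fin 2)).C_mul _)
    have h3 := (((isHomogeneous_X (MvPolynomial (Fin 2) K) (0 : Fin 2)).pow (D.c u)).mul
      ((isHomogeneous_X _ (1 : Fin 2)).pow (D.a u))).mul (h2.pow (D.b u))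
    rwa [one_mul, one_mul, one_mul, h1] at h3
  · rw [hm, pow_zero, one_mul] at hk
    obtain ⟨h1, h2⟩ := linearForm_inj hk
    fin_cases t <;> simp [h1, h2, hxi, hxj, hyi, hyj]
  · rw [hm, pow_zero, one_mul, map_linearForm]
    congr 1
    · exact (aeval_X ![x₁, y₁] 0).symm
    · exact (aeval_X ![x₁, y₁] 1).symm

/-- Here `ℓ_k` is a multiple of `s`, and the factor is the Plücker coordinate `(k, j)`. -/
theorem nonempty_chart_ringEquiv_of_eq_one (hm : D.m = 1) :
    Nonempty (FanoChart (P.toricIdeal K) (i, j) ≃+* MvPolynomial (Fin 1) K) := by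
  refine D.exists_chart_ringEquiv (γ := C (X 0)) (fun u => ?_) ![(D.k, j)]
    (fun x y hxi hxj hyi hyj hk t => ?_) fun x₁ y₁ x₂ y₂ h => ⟨aeval ![x₁], ?_⟩
  · have h1 : D.c u + D.a u = 1 := by
      have := D.sum_eq u
      rw [hm] at this
      omega
    have h3 := (((isHomogeneous_X (MvPolynomial (Fin 1) K) (0 : Fin 2)).pow (D.c u)).mul
      ((isHomogeneous_X _ (1 : Fin 2)).pow (D.a u))).mul
        ((isHomogeneous_C (Fin 2) (X 0 : MvPolynomial (Fin 1) K)).pow (D.b u))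
    rwa [one_mul, one_mul, zero_mul, add_zero, h1] at h3
  · have h0 : linearForm (x D.k) (y D.k) = linearForm (X 0) 0 := by
      rw [hk, hm, linearForm, pow_one, map_zero, zero_mul, add_zero, mul_comm]
    obtain ⟨h1, h2⟩ := linearForm_inj h0
    fin_cases t
    simp [h1, h2, hxj, hyj]
  · have hx : ((aeval ![x₁] : MvPolynomial (Fin 1) K →ₐ[K] _) :
        MvPolynomial (Fin 1) K →+* FanoChart (P.toricIdeal K) (i, j)) (X 0) = x₁ :=
      aeval_X ![x₁] 0
    rw [(eq_zero_of_mul_X_pow_eq h).1 hm.ge, hm, pow_one, MvPolynomial.map_C, hx, linearForm,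
      map_zero, zero_mul, add_zero, mul_comm]

/-- Here `ℓ_k = 0`, so the edge itself is the only line in the chart, as a reduced isolated point.
-/
theorem nonempty_chart_ringEquiv_of_two_le (hm : 2 ≤ D.m) :
    Nonempty (FanoChart (P.toricIdeal K) (i, j) ≃+* MvPolynomial (Fin 0) K) := by
  refine D.exists_chart_ringEquiv (γ := 0) (fun u => ?_) Fin.elim0
    (fun x y hxi hxj hyi hyj hk t => t.elim0) fun x₁ y₁ x₂ y₂ h => ⟨aeval Fin.elim0, ?_⟩
  · by_cases hb : D.b u = 0
    · have h1 := D.sum_eq u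
      rw [hb, mul_zero, add_zero, add_zero] at h1
      have h3 := ((isHomogeneous_X (MvPolynomial (Fin 0) K) (0 : Fin 2)).pow (D.c u)).mul
        ((isHomogeneous_X _ (1 : Fin 2)).pow (D.a u))
      rw [one_mul, one_mul, h1] at h3
      rwa [monomialAt, hb, pow_zero, mul_one]
    · rw [monomialAt, zero_pow hb, mul_zero]
      exact isHomogeneous_zero _ _ _
  · have hxy := eq_zero_of_mul_X_pow_eq h
    rw [hxy.1 (by omega), hxy.2 hm, linearForm, map_zero, map_zero, zero_mul, zero_mul, add_zero,
      mul_zero]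

/-- The chart of a face is an affine space. -/
theorem exists_affineSpace_chart (D : FaceCoordinates i j) : ∃ n : ℕ,
    Nonempty (FanoChart (P.toricIdeal K) (i, j) ≃+* MvPolynomial (Fin n) K) := by
  rcases Nat.lt_or_ge D.m 2 with hm | hm
  · rcases Nat.lt_or_ge D.m 1 with hm1 | hm1
    · exact ⟨2, D.nonempty_chart_ringEquiv_of_eq_zero (by omega)⟩
    · exact ⟨1, D.nonempty_chart_ringEquiv_of_eq_one (by omega)⟩
  · exact ⟨0, D.nonempty_chart_ringEquiv_of_two_le hm⟩

end FaceCoordinates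

/-! ### Regularity of the local rings of the Fano scheme. -/

theorem isRegularRing_and_isDomain_of_isFace (hX : IsNonsingular (P.toricSurface K))
    {i j : P.latticePoints} (h : IsFace i j) :
    IsRegularRing (FanoChart (P.toricIdeal K) (i, j)) ∧
      IsDomain (FanoChart (P.toricIdeal K) (i, j)) := by
  obtain ⟨D⟩ := h.nonempty_faceCoordinates hX
  obtain ⟨n, ⟨e⟩⟩ := D.exists_affineSpace_chart (K := K)
  exact ⟨IsRegularRing.of_ringEquiv e.symm, (e.toMulEquiv.isDomain _)⟩

theorem isRegularLocalRing_and_isDomain_stalk (hX : IsNonsingular (P.toricSurface K))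
    (x : P.fanoSchemeOfLines K) :
    IsRegularLocalRing ((P.fanoSchemeOfLines K).presheaf.stalk x) ∧
      IsDomain ((P.fanoSchemeOfLines K).presheaf.stalk x) := by
  obtain ⟨i, j, h, hx⟩ := exists_isFace_chart x
  obtain ⟨h1, h2⟩ := isRegularRing_and_isDomain_of_isFace hX h
  obtain ⟨y, rfl⟩ := exists_pointOfPrime_eq (fanoGrading (P.toricIdeal K))
    (plucker_mem (P.toricIdeal K) (i, j)) Nat.one_pos x hx
  obtain ⟨e⟩ := nonempty_stalk_ringEquiv (fanoGrading (P.toricIdeal K))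
    (plucker_mem (P.toricIdeal K) (i, j)) Nat.one_pos y
  have h3 : IsDomain (Localization.AtPrime y.asIdeal) :=
    IsLocalization.isDomain_localization y.asIdeal.primeCompl_le_nonZeroDivisors
  exact ⟨IsRegularLocalRing.of_ringEquiv e.symm, e.toMulEquiv.isDomain _⟩

end LatticePolygon

end FanoToric

end

theorem mainTheorem2 {K : Type*} [Field K] [IsAlgClosed K] (P : FanoToric.LatticePolygon)
    (hX : FanoToric.IsNonsingular (P.toricSurface K)) :
    FanoToric.IsNonsingular (P.fanoSchemeOfLines K) ∧
      AlgebraicGeometry.IsReduced (P.fanoSchemeOfLines K) := by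
  have h := FanoToric.LatticePolygon.isRegularLocalRing_and_isDomain_stalk hX
  refine ⟨fun x => (h x).1, ?_⟩
  have (x : P.fanoSchemeOfLines K) : IsReduced ((P.fanoSchemeOfLines K).presheaf.stalk x) :=
    have := (h x).2
    inferInstance
  exact AlgebraicGeometry.isReduced_of_isReduced_stalk _
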